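/- **Theorem.** There is an absolute constant $C>0$ with the following property. Consider networks $f_W(x)=\sigma_L(W_L\sigma_{L-1}(W_{L-1}\cdots\sigma_1(W_1x)\cdots))$ with weight matrices $W_l\in\mathbb R^{m_l\times m_{l-1}}$, where $m_0=d$, $m_L=k$ and $\bar m=\max\{m_0,\dots,m_L\}$, and with fixed activation maps $\sigma_l:\mathbb R^{m_l}\to\mathbb R^{m_l}$ that are $\rho_l$-Lipschitz in the Euclidean norm and satisfy $\sigma_l(0)=0$. Let $s_l>0$ and $a_l\ge 0$ for $l=1,\dots,L$, and let $\mathcal W$ be the set of all $W=(W_1,\dots,W_L)$ such that, for every $l$, $\|W_l\|_\sigma\le s_l$ (spectral norm) and $\|W_l\|_1\le a_l$ (entrywise $\ell_1$ norm). Let $\mathcal B(x)\subseteq\mathbb R^d$ be an arbitrary nonempty perturbation set for each $x\in\mathbb R^d$, let $\mathcal D$ be any probability distribution on $\mathbb R^d\times\{1,\dots,k\}$, let $n\ge1$ and $\delta\in(0,1)$, and let $\mathcal S=\{(x_i,y_i)\}_{i=1}^n$ be drawn i.i.d. from $\mathcal D$. For $r\ge 0$ and $\tilde B\ge 0$ put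 $$\Phi(\tilde B,r)=C\left(\frac{\tilde B\,r\prod_{i=1}^L\rho_is_i}{\sqrt n}\Big(\sum_{i=1}^L\frac{a_i^{2/3}}{s_i^{2/3}}\Big)^{3/2}(1+\ln n)\sqrt{\ln(2\bar m^2)}+\sqrt{\frac{\ln(1/\delta)}{n}}\right).$$ (1) Let the loss $\ell:\mathbb R^k\times\{1,\dots,k\}\to[0,1]$ be $\rho$-Lipschitz in its first argument with respect to the Euclidean norm, and suppose that the robust loss $(x,y)\mapsto\sup_{x'\in\mathcal B(x)}\ell(f_W(x'),y)$ is $\mathcal D$-measurable for every $W\in\mathcal W$. Then with probability at least $1-\delta$ over $\mathcal S$, simultaneously for all $W\in\mathcal W$ and all $\tilde B$ with $\|x'\|_2\le\tilde B$ for every $x'\in\mathcal B(x_i)$, $i=1,\dots,n$, $$\mathbb E_{(x,y)\sim\mathcal D}\sup_{x'\in\mathcal B(x)}\ell(f_W(x'),y)-\frac1n\sum_{i=1}^n\sup_{x'\in\mathcal B(x_i)}\ell(f_W(x'),y_i)\le\Phi(\tilde B,\rho).$$ (2) Let $\gamma>0$, let $\arg\max$ be taken with any fixed tie-breaking rule,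 and suppose that the events $\{(x,y):\exists x'\in\mathcal B(x),\ f_W(x')_y\le t+\max_{j\ne y}f_W(x')_j\}$ are $\mathcal D$-measurable for all $W\in\mathcal W$ and $0\le t\le\gamma$. Then with probability at least $1-\delta$ over $\mathcal S$, simultaneously for all $W\in\mathcal W$ and all $\tilde B$ as in (1), $$\mathbb P_{(x,y)\sim\mathcal D}\{\exists x'\in\mathcal B(x):\ y\ne\arg\max_jf_W(x')_j\}-\frac1n\sum_{i=1}^n\mathbf 1\Big(\exists x'\in\mathcal B(x_i):\ f_W(x')_{y_i}\le\gamma+\max_{j\ne y_i}f_W(x')_j\Big)\le\Phi(\tilde B,1/\gamma).$$ (If the first event is not measurable, its probability is read as outer probability; a maximum over the empty set is $-\infty$.) -/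

import Mathlib

open MeasureTheory
open scoped NNReal BigOperators

noncomputable section

namespace RobustNet

/-- The Euclidean space of dimension `d`, carrying the `ℓ²` norm. -/
abbrev Vec (d : ℕ) : Type := EuclideanSpace ℝ (Fin d)

/-- Weight matrices of a network with `L` layers and widths `m 0, …, m L`. -/
abbrev Weights {L : ℕ} (m : Fin (L + 1) → ℕ) : Type :=
  (i : Fin L) → Matrix (Fin (m i.succ)) (Fin (m i.castSucc)) ℝ

/-- Activations: one map on each of the spaces of dimensions `m 1, …, m L`. -/
abbrev Activations {L : ℕ} (m : Fin (L + 1) → ℕ) : Type :=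
  (i : Fin L) → Vec (m i.succ) → Vec (m i.succ)

/-- A labelled example: an input of dimension `m 0` and one of `m L` class labels. -/
abbrev Example {L : ℕ} (m : Fin (L + 1) → ℕ) : Type :=
  Vec (m 0) × Fin (m (Fin.last L))

/-- The spectral norm of a matrix: its operator norm with respect to Euclidean norms. -/
def matSpectralNorm {p q : ℕ} (A : Matrix (Fin p) (Fin q) ℝ) : ℝ :=
  ‖LinearMap.toContinuousLinearMap (Matrix.toEuclideanLin A)‖

/-- The entrywise `ℓ¹` norm of a matrix. -/
def entrywiseL1 {p q : ℕ} (A : Matrix (Fin p) (Fin q) ℝ) : ℝ :=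
  ∑ i, ∑ j, |A i j|

/-- The output of the first `i` layers: `x ↦ σ_i (W_i (⋯ σ_1 (W_1 x) ⋯))`. -/
def layerOutput {L : ℕ} {m : Fin (L + 1) → ℕ} (σ : Activations m) (W : Weights m) :
    (i : Fin (L + 1)) → Vec (m 0) → Vec (m i) :=
  Fin.induction (motive := fun i => Vec (m 0) → Vec (m i)) id
    (fun i g x => σ i (Matrix.toEuclideanLin (W i) (g x)))

/-- The network `x ↦ σ_L (W_L (σ_{L-1} (W_{L-1} ⋯ σ_1 (W_1 x) ⋯)))`. -/
def net {L : ℕ} {m : Fin (L + 1) → ℕ} (σ : Activations m) (W : Weights m) :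
    Vec (m 0) → Vec (m (Fin.last L)) :=
  layerOutput σ W (Fin.last L)

/-- Weights whose layers obey the spectral norm bounds `s` and the `ℓ¹` norm bounds `a`. -/
def weightClass {L : ℕ} (m : Fin (L + 1) → ℕ) (s a : Fin L → ℝ) : Set (Weights m) :=
  {W | ∀ i, matSpectralNorm (W i) ≤ s i ∧ entrywiseL1 (W i) ≤ a i}

/-- The robust loss `(x, y) ↦ sup_{x' ∈ B x} ℓ(f x', y)`. -/
def robustLoss {L : ℕ} {m : Fin (L + 1) → ℕ}
    (loss : Vec (m (Fin.last L)) → Fin (m (Fin.last L)) → ℝ)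
    (B : Vec (m 0) → Set (Vec (m 0))) (σ : Activations m) (W : Weights m)
    (p : Example m) : ℝ :=
  ⨆ x' : B p.1, loss (net σ W x') p.2

/-- The robust generalization gap: robust population risk minus robust empirical risk. -/
def robustGap {L n : ℕ} {m : Fin (L + 1) → ℕ}
    (loss : Vec (m (Fin.last L)) → Fin (m (Fin.last L)) → ℝ)
    (B : Vec (m 0) → Set (Vec (m 0))) (σ : Activations m) (D : Measure (Example m))
    (S : Fin n → Example m) (W : Weights m) : ℝ :=
  (∫ p, robustLoss loss B σ W p ∂D) - (1 / (n : ℝ)) * ∑ i, robustLoss loss B σ W (S i)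

/-- Examples `(x, y)` for which some `x' ∈ B x` is misclassified by the rule `pick`. -/
def robustErrorSet {L : ℕ} {m : Fin (L + 1) → ℕ}
    (pick : Vec (m (Fin.last L)) → Fin (m (Fin.last L)))
    (B : Vec (m 0) → Set (Vec (m 0))) (σ : Activations m) (W : Weights m) :
    Set (Example m) :=
  {p | ∃ x' ∈ B p.1, p.2 ≠ pick (net σ W x')}

/-- Examples `(x, y)` such that `f(x')_y ≤ t + max_{j ≠ y} f(x')_j` for some `x' ∈ B x`
(the maximum is `-∞` if there is only one class). -/
def robustMarginErrorSet {L : ℕ} {m : Fin (L + 1) → ℕ}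
    (B : Vec (m 0) → Set (Vec (m 0))) (σ : Activations m) (t : ℝ) (W : Weights m) :
    Set (Example m) :=
  {p | ∃ x' ∈ B p.1, ∃ j, j ≠ p.2 ∧ net σ W x' p.2 ≤ t + net σ W x' j}

/-- The robust margin gap: robust population classification error minus empirical robust
margin error at margin `γ`. -/
def robustMarginGap {L n : ℕ} {m : Fin (L + 1) → ℕ}
    (pick : Vec (m (Fin.last L)) → Fin (m (Fin.last L)))
    (B : Vec (m 0) → Set (Vec (m 0))) (σ : Activations m) (γ : ℝ) (D : Measure (Example m))
    (S : Fin n → Example m) (W : Weights m) : ℝ :=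
  D.real (robustErrorSet pick B σ W) -
    (1 / (n : ℝ)) * ∑ i, (robustMarginErrorSet B σ γ W).indicator (fun _ => (1 : ℝ)) (S i)

/-- `Btil` bounds the `ℓ²` norm of all adversarial examples of the sample `S`. -/
def BoundsAdversarial {L n : ℕ} {m : Fin (L + 1) → ℕ}
    (B : Vec (m 0) → Set (Vec (m 0))) (S : Fin n → Example m) (Btil : ℝ) : Prop :=
  ∀ i, ∀ x' ∈ B (S i).1, ‖x'‖ ≤ Btil

/-- The largest width `max {m 0, …, m L}`. -/
def maxWidth {L : ℕ} (m : Fin (L + 1) → ℕ) : ℕ := Finset.univ.sup m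

/-- The leading term
`Btil * r * (∏ ρ_i s_i) * (∑ (a_i / s_i)^(2/3))^(3/2) / √n`. -/
def leadingTerm {L : ℕ} (n : ℕ) (Btil r : ℝ) (ρ s a : Fin L → ℝ) : ℝ :=
  Btil * r * (∏ i, ρ i * s i) / √(n : ℝ) *
    (∑ i, a i ^ (2 / 3 : ℝ) / s i ^ (2 / 3 : ℝ)) ^ (3 / 2 : ℝ)

/-- The logarithmic factor `(1 + ln n) √(ln (2 M²))` for sample size `n` and width `M`. -/
def logFactor (n M : ℕ) : ℝ :=
  (1 + Real.log n) * √(Real.log (2 * (M : ℝ) ^ 2))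

end RobustNet

end

/-! The only randomness is in the sample, and the perturbation sets never have to be covered. If two
weights in the class are close layer by layer, relative to `s`, then the outputs of the two networks
differ by at most that relative distance times `∏ ρ_l s_l` times `‖x‖` (`norm_net_sub_le`). This is
uniform over all inputs of norm at most `Btil`, and a supremum of uniformly close functions is
close, so the robust losses inherit the estimate (`abs_robustLoss_sub_le`). It remains to measure
the size of the weight class.

A matrix in an entrywise `ℓ¹` ball of radius `a` is within Frobenius distance `O(a / √k)` of an
average of `k` signed single-entry matrices (Maurey), so `k` letters from an alphabet of size `2 M ^
2` encode it to that accuracy. Distributing a budget of `4 ^ j` letters among the layers in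
proportion to `(a_l / s_l) ^ (2/3)`, the optimal split for `∑ (a_l / s_l) / √k_l`, gives relative
accuracy of order `(∑ (a_l / s_l) ^ (2/3)) ^ (3/2) / 2 ^ j`. This is the complexity in the statement
(`exists_codes_weightDist_le`).

Entropy `4 ^ j` at scale `2 ^ (-j)` is the critical case of Dudley's chaining: every scale
contributes equally, and about `log n` scales matter, whence the factor `1 + ln n`
(`rad_le_of_codes`).

Symmetrization and McDiarmid's inequality bound the deviations by the empirical Rademacher average
of the sample itself (`exists_event_deviation_le`). Since `Btil` enters only through that average,
the event does not depend on it, and all `Btil` are handled at once without a union bound.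

This is carried out for a countable dense family of weights. Passing to all weights needs only lower
semicontinuity of the robust loss on the population side, where `B x` may be unbounded, and
continuity on the sample. The margin bound follows by applying the Lipschitz bound to a ramp loss
lying between the two indicators. -/

namespace RobustNet

/-! ### Averages over sign patterns and Massart's finite class lemma. -/

/-- The real number `±1` attached to a sign. -/
noncomputable def signVal (b : Bool) : ℝ := if b then 1 else -1

/-- The correlation of a vector with a sign pattern. -/
noncomputable def signSum {n : ℕ} (e : Fin n → Bool) (x : Fin n → ℝ) : ℝ :=
  ∑ i, signVal (e i) * x i

/-- The average over all sign patterns. -/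
noncomputable def signAvg {n : ℕ} (f : (Fin n → Bool) → ℝ) : ℝ := (∑ e, f e) / 2 ^ n

/-- The (unnormalized) Rademacher average of a family of vectors. -/
noncomputable def rad {n : ℕ} {T : Type*} (v : T → Fin n → ℝ) : ℝ :=
  signAvg fun e => ⨆ t, signSum e (v t)

lemma signVal_not (b : Bool) : signVal (!b) = -signVal b := by
  cases b <;> simp [signVal]

lemma abs_signVal (b : Bool) : |signVal b| = 1 := by
  cases b <;> simp [signVal]

section signAvg

variable {n : ℕ}

lemma signAvg_mono {f g : (Fin n → Bool) → ℝ} (h : ∀ e, f e ≤ g e) : signAvg f ≤ signAvg g := by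
  unfold signAvg
  gcongr with e
  exact h e

lemma signAvg_add (f g : (Fin n → Bool) → ℝ) :
    signAvg (fun e => f e + g e) = signAvg f + signAvg g := by
  simp [signAvg, Finset.sum_add_distrib, add_div]

lemma signAvg_const_mul (c : ℝ) (f : (Fin n → Bool) → ℝ) :
    signAvg (fun e => c * f e) = c * signAvg f := by
  simp [signAvg, ← Finset.mul_sum, mul_div_assoc]

lemma signAvg_sum {ι : Type*} (s : Finset ι) (f : ι → (Fin n → Bool) → ℝ) :
    signAvg (fun e => ∑ j ∈ s, f j e) = ∑ j ∈ s, signAvg (f j) := by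
  simp only [signAvg, Finset.sum_div]
  rw [Finset.sum_comm]

lemma signAvg_const (c : ℝ) : signAvg (fun _ : Fin n → Bool => c) = c := by
  simp [signAvg]

lemma signAvg_not (f : (Fin n → Bool) → ℝ) : signAvg (fun e => f fun i => !e i) = signAvg f := by
  unfold signAvg
  congr 1
  exact Function.Bijective.sum_comp
    (Function.Involutive.bijective (f := fun (e : Fin n → Bool) i => !e i) (fun e => by simp)) f

lemma signSum_not (e : Fin n → Bool) (x : Fin n → ℝ) :
    signSum (fun i => !e i) x = -signSum e x := by
  simp [signSum, signVal_not]

lemma signSum_sub (e : Fin n → Bool) (x y : Fin n → ℝ) :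
    signSum e (x - y) = signSum e x - signSum e y := by
  simp [signSum, mul_sub, Finset.sum_sub_distrib]

lemma signSum_smul (e : Fin n → Bool) (c : ℝ) (x : Fin n → ℝ) :
    signSum e (c • x) = c * signSum e x := by
  simp only [signSum, Finset.mul_sum, Pi.smul_apply, smul_eq_mul]
  exact Finset.sum_congr rfl fun i _ => by ring

lemma abs_signSum_le (e : Fin n → Bool) {x : Fin n → ℝ} {c : ℝ} (h : ∀ i, |x i| ≤ c) :
    |signSum e x| ≤ n * c := by
  unfold signSum
  refine (Finset.abs_sum_le_sum_abs _ _).trans ?_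
  refine (Finset.sum_le_sum (g := fun _ => c) fun i _ => ?_).trans (by simp)
  rw [abs_mul, abs_signVal, one_mul]
  exact h i

lemma signAvg_signSum_const (x : Fin n → ℝ) : signAvg (fun e => signSum e x) = 0 := by
  have h := signAvg_not (fun e => signSum e x)
  simp only [signSum_not] at h
  have h' := signAvg_const_mul (-1) (fun e => signSum e x)
  simp only [neg_mul, one_mul] at h'
  linarith

/-- The signs are independent, so the average factors into `∏ cosh (x i)`, and `cosh t ≤ exp (t ^ 2
/ 2)`. -/
lemma signAvg_exp_signSum_le (x : Fin n → ℝ) :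
    signAvg (fun e => Real.exp (signSum e x)) ≤ Real.exp ((∑ i, x i ^ 2) / 2) := by
  have h1 : ∑ e : Fin n → Bool, Real.exp (signSum e x)
      = ∏ i, ∑ b : Bool, Real.exp (signVal b * x i) := by
    rw [Fintype.prod_sum]
    simp [signSum, Real.exp_sum]
  have h2 : ∀ i, ∑ b : Bool, Real.exp (signVal b * x i) = 2 * Real.cosh (x i) := fun i => by
    simp [signVal, Real.cosh_eq]
    ring
  unfold signAvg
  rw [h1, div_le_iff₀ (by positivity), Finset.sum_div, Real.exp_sum]
  simp only [h2, Finset.prod_mul_distrib, Finset.prod_const, Finset.card_univ, Fintype.card_fin]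
  rw [mul_comm]
  gcongr with i
  exact Real.cosh_le_exp_half_sq _

/-- Massart's finite class lemma, for a choice of vector depending on the signs. -/
lemma signAvg_signSum_le_of_card {κ : Type*} [Fintype κ] (X : κ → Fin n → ℝ)
    (c : (Fin n → Bool) → κ) {r H : ℝ} (hr : 0 < r) (hH : 0 < H)
    (hcard : (Fintype.card κ : ℝ) ≤ Real.exp H) (hX : ∀ e, ∑ i, X (c e) i ^ 2 ≤ r ^ 2) :
    signAvg (fun e => signSum e (X (c e))) ≤ r * √(2 * H) := by
  classical
  -- The usual optimal exponent: a vector of norm at most `r` scaled by `l` has half squared norm at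
  -- most `H`.
  set l : ℝ := √(2 * H) / r with hl
  have hs : √(2 * H) ^ 2 = 2 * H := Real.sq_sqrt (by positivity)
  have hs0 : 0 < √(2 * H) := by positivity
  have hl0 : 0 < l := by positivity
  have hlr : (l * r) ^ 2 = 2 * H := by rw [hl, div_mul_cancel₀ _ hr.ne', hs]
  set A : Finset κ := Finset.univ.filter fun k => ∑ i, X k i ^ 2 ≤ r ^ 2
  -- The tangent line of `exp` at `0`, shifted by `2 * H`, replaces Jensen's inequality and the
  -- logarithm. The exponential of the chosen vector is then one of the nonnegative terms of a sum
  -- over all short vectors.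
  have key : ∀ e, l * signSum e (X (c e))
      ≤ (2 * H - 1) + ∑ k ∈ A, Real.exp (-(2 * H)) * Real.exp (signSum e (l • X k)) := by
    intro e
    have h1 := Real.add_one_le_exp (l * signSum e (X (c e)) - 2 * H)
    have h2 : Real.exp (l * signSum e (X (c e)) - 2 * H)
        = Real.exp (-(2 * H)) * Real.exp (signSum e (l • X (c e))) := by
      rw [signSum_smul, ← Real.exp_add]; ring_nf
    have h3 := Finset.single_le_sum (s := A)
      (f := fun k => Real.exp (-(2 * H)) * Real.exp (signSum e (l • X k)))
      (fun _ _ => by positivity) (a := c e) (by simpa [A] using hX e)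
    linarith
  have h4 : l * signAvg (fun e => signSum e (X (c e))) ≤ 2 * H := by
    rw [← signAvg_const_mul]
    refine (signAvg_mono key).trans ?_
    rw [signAvg_add, signAvg_const]
    have h5 : signAvg (fun e : Fin n → Bool =>
        ∑ k ∈ A, Real.exp (-(2 * H)) * Real.exp (signSum e (l • X k)))
        = ∑ k ∈ A, Real.exp (-(2 * H)) * signAvg (fun e => Real.exp (signSum e (l • X k))) := by
      rw [signAvg_sum]
      exact Finset.sum_congr rfl fun k _ => signAvg_const_mul _ _
    rw [h5]
    have h6 : ∀ k ∈ A, Real.exp (-(2 * H)) * signAvg (fun e => Real.exp (signSum e (l • X k)))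
        ≤ Real.exp (-H) := by
      intro k hk
      have hk' : ∑ i, X k i ^ 2 ≤ r ^ 2 := by simpa [A] using hk
      have h7 := signAvg_exp_signSum_le (l • X k)
      have h8 : (∑ i, (l • X k) i ^ 2) / 2 ≤ H := by
        simp only [Pi.smul_apply, smul_eq_mul, mul_pow, ← Finset.mul_sum]
        have : l ^ 2 * ∑ i, X k i ^ 2 ≤ l ^ 2 * r ^ 2 := by gcongr
        rw [mul_pow] at hlr
        linarith
      calc _ ≤ Real.exp (-(2 * H)) * Real.exp H := by
            gcongr
            exact h7.trans (Real.exp_le_exp.2 h8)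
        _ = Real.exp (-H) := by rw [← Real.exp_add]; ring_nf
    have h9 := Finset.sum_le_card_nsmul A _ _ h6
    rw [nsmul_eq_mul] at h9
    have h10 : (A.card : ℝ) * Real.exp (-H) ≤ 1 := by
      have : (A.card : ℝ) ≤ Real.exp H :=
        le_trans (by exact_mod_cast Finset.card_le_univ A) hcard
      calc _ ≤ Real.exp H * Real.exp (-H) := by gcongr
        _ = 1 := by rw [← Real.exp_add]; simp
    linarith
  have h11 : signAvg (fun e => signSum e (X (c e))) ≤ 2 * H / l := by
    rw [le_div_iff₀ hl0]; linarith
  refine h11.trans (le_of_eq ?_)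
  rw [hl, div_div_eq_mul_div, div_eq_iff hs0.ne']
  nlinarith

end signAvg

/-! ### Chaining for Rademacher averages. -/

lemma bddAbove_range_signSum {n : ℕ} {T : Type*} {v : T → Fin n → ℝ} {c : ℝ}
    (hv : ∀ t i, |v t i| ≤ c) (e : Fin n → Bool) :
    BddAbove (Set.range fun t => signSum e (v t)) :=
  ⟨n * c, by rintro _ ⟨t, rfl⟩; exact (abs_le.1 (abs_signSum_le e (hv t))).2⟩

/-- A near-maximizer can be chosen for each sign pattern separately. Chaining then follows one index
per pattern instead of a supremum. -/
lemma rad_le_of_selection {n : ℕ} {T : Type*} [Nonempty T] {v : T → Fin n → ℝ} {b : ℝ}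
    (h : ∀ t : (Fin n → Bool) → T, signAvg (fun e => signSum e (v (t e))) ≤ b) : rad v ≤ b := by
  refine le_of_forall_pos_le_add fun η hη => ?_
  have : ∀ e : Fin n → Bool, ∃ t, (⨆ t, signSum e (v t)) < signSum e (v t) + η := fun e => by
    obtain ⟨t, ht⟩ := exists_lt_of_lt_ciSup (sub_lt_self (⨆ t, signSum e (v t)) hη)
    exact ⟨t, by linarith⟩
  choose t ht using this
  calc rad v ≤ signAvg (fun e => signSum e (v (t e)) + η) := signAvg_mono fun e => (ht e).le
    _ ≤ b + η := by rw [signAvg_add, signAvg_const]; linarith [h t]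

/-- A chaining bound for Rademacher averages, at positive scale `K`. -/
lemma rad_le_of_codes_of_pos {n : ℕ} (hn : 0 < n) {T : Type*} [Nonempty T] {v : T → Fin n → ℝ}
    {κ : ℕ → Type*} [∀ j, Fintype (κ j)] [Subsingleton (κ 0)] (c : ∀ j, T → κ j)
    {K H : ℝ} (hK : 0 < K) (hH : Real.log 2 ≤ H)
    (hcard : ∀ j, (Fintype.card (κ j) : ℝ) ≤ Real.exp (4 ^ j * H))
    (hc : ∀ j s t, c j s = c j t → ∀ i, |v s i - v t i| ≤ K * (1 / 2) ^ j) :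
    rad v ≤ 18 * K * √(n * H) * (1 + Real.log n) := by
  have hH0 : 0 < H := (Real.log_pos one_lt_two).trans_le hH
  have hn1 : (1 : ℝ) ≤ n := by exact_mod_cast hn
  apply rad_le_of_selection
  intro t
  set p : ∀ j, κ j → Fin n → ℝ := fun j k => v (Function.invFun (c j) k) with hp
  have hpv : ∀ j s i, |v s i - p j (c j s) i| ≤ K * (1 / 2) ^ j := fun j s i =>
    hc j _ _ (Function.invFun_eq ⟨s, rfl⟩).symm i
  -- The chain stops once `n * (1 / 2) ^ J ≤ 1`, so that the trivial bound on the remainder costs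
  -- only `K`.
  set J := Nat.clog 2 n with hJ
  have hdec : ∀ e, signSum e (v (t e)) = signSum e (p 0 (c 0 (t e)))
      + ∑ j ∈ Finset.range J,
          signSum e (p (j + 1) (c (j + 1) (t e)) - p j (c j (t e)))
      + signSum e (v (t e) - p J (c J (t e))) := fun e => by
    simp only [signSum_sub]
    rw [Finset.sum_range_sub (fun j => signSum e (p j (c j (t e))))]
    ring
  simp only [hdec]
  rw [signAvg_add, signAvg_add, signAvg_sum]
  -- With a single code at scale `0` the starting vector is independent of the signs, hence averages
  -- to zero.
  have h0 : signAvg (fun e => signSum e (p 0 (c 0 (t e)))) = 0 := by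
    have : ∀ e, c 0 (t e) = c 0 (t fun _ => true) := fun e => Subsingleton.elim _ _
    simp only [this]
    exact signAvg_signSum_const _
  have hlast : signAvg (fun e => signSum e (v (t e) - p J (c J (t e)))) ≤ K := by
    refine (signAvg_mono (g := fun _ => K) fun e => ?_).trans (signAvg_const _).le
    refine (le_abs_self _).trans
      ((abs_signSum_le e (c := K * (1 / 2) ^ J) fun i => hpv J (t e) i).trans ?_)
    have : (n : ℝ) ≤ 2 ^ J := by exact_mod_cast Nat.le_pow_clog one_lt_two n
    calc (n : ℝ) * (K * (1 / 2) ^ J) ≤ 2 ^ J * (K * (1 / 2) ^ J) := by gcongr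
      _ = K := by rw [mul_left_comm, ← mul_pow]; norm_num
  have hstep : ∀ j ∈ Finset.range J, signAvg (fun e =>
      signSum e (p (j + 1) (c (j + 1) (t e)) - p j (c j (t e)))) ≤ 7 * K * √(n * H) := by
    intro j _
    -- A link is determined by a pair of codes, with entropy `(4 ^ (j + 1) + 4 ^ j) * H = 5 * 4 ^ j
    -- * H`. The growth of the entropy cancels the decay of the radius, so the bound is the same for
    -- every `j`.
    have h1 := signAvg_signSum_le_of_card (κ := κ (j + 1) × κ j) (n := n)
      (fun k => p (j + 1) k.1 - p j k.2) (fun e => (c (j + 1) (t e), c j (t e)))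
      (r := √n * (2 * K * (1 / 2) ^ j)) (H := 5 * 4 ^ j * H) (by positivity) (by positivity)
      (by
        rw [Fintype.card_prod, Nat.cast_mul]
        calc _ ≤ Real.exp (4 ^ (j + 1) * H) * Real.exp (4 ^ j * H) := by
              gcongr <;> apply hcard
          _ = _ := by rw [← Real.exp_add]; ring_nf)
      (fun e => by
        rw [mul_pow, Real.sq_sqrt (by positivity)]
        refine (Finset.sum_le_sum (g := fun _ => (2 * K * (1 / 2) ^ j) ^ 2) fun i _ => ?_).trans
          (by simp)
        refine sq_le_sq' ?_ ?_
        all_goals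
          have h2 := abs_le.1 (hpv j (t e) i)
          have h3 := abs_le.1 (hpv (j + 1) (t e) i)
          have h4 : K * (1 / 2) ^ (j + 1) ≤ K * (1 / 2) ^ j := by
            rw [pow_succ]
            nlinarith [show (0 : ℝ) < K * (1 / 2) ^ j by positivity]
          simp only [Pi.sub_apply]
          linarith [h2.1, h2.2, h3.1, h3.2])
    refine h1.trans ?_
    have h5 : √(2 * (5 * 4 ^ j * H)) = 2 ^ j * √10 * √H := by
      rw [show (2 * (5 * 4 ^ j * H) : ℝ) = (2 ^ j) ^ 2 * 10 * H by
        rw [← pow_mul, mul_comm j 2, pow_mul]; norm_num; ring]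
      rw [Real.sqrt_mul (by positivity), Real.sqrt_mul (by positivity),
        Real.sqrt_sq (by positivity)]
    have h6 : √(10 : ℝ) ≤ 7 / 2 := Real.sqrt_le_iff.2 ⟨by norm_num, by norm_num⟩
    have h7 : ((1 : ℝ) / 2) ^ j * 2 ^ j = 1 := by rw [← mul_pow]; norm_num
    rw [h5, Real.sqrt_mul (by positivity)]
    calc √(n : ℝ) * (2 * K * (1 / 2) ^ j) * (2 ^ j * √10 * √H)
        = 2 * K * √10 * (√n * √H) * ((1 / 2) ^ j * 2 ^ j) := by ring
      _ = 2 * K * (√n * √H) * √10 := by rw [h7]; ring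
      _ ≤ 2 * K * (√n * √H) * (7 / 2) := by gcongr
      _ = _ := by ring
  have hsum := Finset.sum_le_card_nsmul _ _ _ hstep
  rw [Finset.card_range, nsmul_eq_mul] at hsum
  have hlog2 : (0.69 : ℝ) < Real.log 2 := by linarith [Real.log_two_gt_d9]
  have hJle : (J : ℝ) ≤ 2 * (1 + Real.log n) := by
    rcases Nat.eq_zero_or_pos J with h | h
    · rw [h]
      have := Real.log_nonneg hn1
      push_cast
      linarith
    · have h1 : 2 ^ (J - 1) < n := by
        rw [← Nat.lt_clog_iff_pow_lt one_lt_two]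
        omega
      have h2 : ((J - 1 : ℕ) : ℝ) * Real.log 2 ≤ Real.log n := by
        rw [← Real.log_pow]
        exact Real.log_le_log (by positivity) (by exact_mod_cast h1.le)
      rw [Nat.cast_sub (by omega)] at h2
      push_cast at h2
      have hJ1 : (1 : ℝ) ≤ J := by exact_mod_cast h
      nlinarith
  -- This lets the remainder `K` be absorbed: `14 + 2 ≤ 18`.
  have hs : (1 / 2 : ℝ) ≤ √(n * H) := by
    apply Real.le_sqrt_of_sq_le
    nlinarith
  have hlogn := Real.log_nonneg hn1
  have hKs : 0 < K * √(n * H) := by positivity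
  have h8 : (J : ℝ) * (7 * K * √(n * H)) ≤ 2 * (1 + Real.log n) * (7 * K * √(n * H)) := by gcongr
  have h9 : K ≤ 2 * (K * √(n * H)) := by nlinarith
  have h10 : K * √(n * H) ≤ K * √(n * H) * (1 + Real.log n) := by nlinarith
  rw [h0]
  nlinarith

/-- A chaining bound for Rademacher averages: the vectors are encoded, at every dyadic scale, by
finite alphabets of controlled size. -/
lemma rad_le_of_codes {n : ℕ} (hn : 0 < n) {T : Type*} [Nonempty T] {v : T → Fin n → ℝ}
    {κ : ℕ → Type*} [∀ j, Fintype (κ j)] [Subsingleton (κ 0)] (c : ∀ j, T → κ j)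
    {K H : ℝ} (hK : 0 ≤ K) (hH : Real.log 2 ≤ H)
    (hcard : ∀ j, (Fintype.card (κ j) : ℝ) ≤ Real.exp (4 ^ j * H))
    (hc : ∀ j s t, c j s = c j t → ∀ i, |v s i - v t i| ≤ K * (1 / 2) ^ j) :
    rad v ≤ 18 * K * √(n * H) * (1 + Real.log n) := by
  -- Massart's lemma was used with positive radii; `K = 0` is reached as a limit from above.
  have h : ∀ K' > K, rad v ≤ 18 * K' * √(n * H) * (1 + Real.log n) := fun K' hK' =>
    rad_le_of_codes_of_pos hn c (hK.trans_lt hK') hH hcard fun j s t hst i =>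
      (hc j s t hst i).trans (by gcongr)
  refine ge_of_tendsto (f := fun K' => 18 * K' * √(n * H) * (1 + Real.log n))
    (x := nhdsWithin K (Set.Ioi K)) ?_ ?_
  · refine Filter.Tendsto.mono_left (Continuous.tendsto (by fun_prop) K) nhdsWithin_le_nhds
  · filter_upwards [self_mem_nhdsWithin] with K' hK' using h K' hK'

/-! ### Integrals and suprema of bounded functions. -/

lemma integrable_of_measurable_of_abs_le {Ω : Type*} [MeasurableSpace Ω] {μ : Measure Ω}
    [IsFiniteMeasure μ] {f : Ω → ℝ} {b : ℝ} (hf : Measurable f) (hb : ∀ x, |f x| ≤ b) :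
    Integrable f μ :=
  Integrable.of_mem_Icc (-b) b hf.aemeasurable (.of_forall fun x => abs_le.1 (hb x))

lemma abs_integral_le_of_abs_le {Ω : Type*} [MeasurableSpace Ω] {μ : Measure Ω}
    [IsProbabilityMeasure μ] {f : Ω → ℝ} {b : ℝ} (hb : ∀ x, |f x| ≤ b) :
    |∫ x, f x ∂μ| ≤ b := by
  simpa using norm_integral_le_of_norm_le_const (μ := μ) (f := f) (.of_forall hb)

lemma abs_ciSup_le_of_abs_le {ι : Type*} [Nonempty ι] {f : ι → ℝ} {c : ℝ}
    (h : ∀ j, |f j| ≤ c) : |⨆ j, f j| ≤ c := by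
  have hb : BddAbove (Set.range f) := ⟨c, by rintro _ ⟨j, rfl⟩; exact (abs_le.1 (h j)).2⟩
  have i : ι := Classical.arbitrary ι
  exact abs_le.2 ⟨(abs_le.1 (h i)).1.trans (le_ciSup hb i), ciSup_le fun j => (abs_le.1 (h j)).2⟩

lemma ciSup_le_ciSup_add {ι : Type*} [Nonempty ι] {f g : ι → ℝ} {c : ℝ}
    (hg : BddAbove (Set.range g)) (h : ∀ j, f j ≤ g j + c) : ⨆ j, f j ≤ (⨆ j, g j) + c :=
  ciSup_le fun j => (h j).trans (by gcongr; exact le_ciSup hg j)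

lemma abs_ciSup_sub_ciSup_le {ι : Type*} [Nonempty ι] {f g : ι → ℝ} {c : ℝ}
    (hf : BddAbove (Set.range f)) (hg : BddAbove (Set.range g)) (h : ∀ j, |f j - g j| ≤ c) :
    |(⨆ j, f j) - ⨆ j, g j| ≤ c := by
  have h1 := ciSup_le_ciSup_add (f := f) hg (c := c) fun j => by linarith [(abs_le.1 (h j)).2]
  have h2 := ciSup_le_ciSup_add (f := g) hf (c := c) fun j => by linarith [(abs_le.1 (h j)).1]
  exact abs_le.2 ⟨by linarith, by linarith⟩

/-! ### McDiarmid's inequality. -/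

section BoundedDifferences

variable {Ω : Type*} [MeasurableSpace Ω] (D : Measure Ω) [IsProbabilityMeasure D]

lemma measurable_fin_cons {Ω : Type*} [MeasurableSpace Ω] {n : ℕ} :
    Measurable fun p : Ω × (Fin n → Ω) => (Fin.cons p.1 p.2 : Fin (n + 1) → Ω) := by
  rw [measurable_pi_iff]
  refine Fin.cases ?_ fun i => ?_
  · simpa using measurable_fst
  · simpa [Function.comp_def] using (measurable_pi_apply i).comp measurable_snd

lemma integral_pi_succ {n : ℕ} {f : (Fin (n + 1) → Ω) → ℝ} {b : ℝ} (hf : Measurable f)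
    (hb : ∀ S, |f S| ≤ b) :
    ∫ S, f S ∂(Measure.pi fun _ => D)
      = ∫ S, (∫ x, f (Fin.cons x S) ∂D) ∂(Measure.pi fun _ : Fin n => D) := by
  rw [← ((measurePreserving_piFinSuccAbove (fun _ : Fin (n + 1) => D) 0).symm).integral_comp']
  simp_rw [MeasurableEquiv.piFinSuccAbove_symm_apply, Fin.insertNthEquiv, Equiv.coe_fn_mk,
    Fin.insertNth_zero']
  rw [integral_prod_symm]
  exact integrable_of_measurable_of_abs_le (b := b) (hf.comp measurable_fin_cons) fun x => hb _

/-- Induction by averaging out the first coordinate: the average `h` again has bounded differences,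
and Hoeffding's lemma in that coordinate costs one factor `exp (c ^ 2 * l ^ 2 / 2)`. -/
lemma integral_exp_le_of_bounded_differences (l : ℝ) {c : ℝ} (hc0 : 0 ≤ c) (b : ℝ) (n : ℕ) :
    ∀ f : (Fin n → Ω) → ℝ, Measurable f → (∀ S, |f S| ≤ b) →
      (∀ S i x, |f (Function.update S i x) - f S| ≤ c) →
      ∫ S, Real.exp (l * (f S - ∫ S', f S' ∂(Measure.pi fun _ => D))) ∂(Measure.pi fun _ => D)
        ≤ Real.exp (n * (c ^ 2 * l ^ 2 / 2)) := by
  induction n with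
  | zero =>
    intro f hf hb hc
    have : ∀ S, f S = f default := fun S => by rw [Subsingleton.elim S default]
    simp [this]
  | succ n ih =>
    intro f hf hb hc
    have hfx : ∀ S, Measurable fun x => f (Fin.cons x S) := fun S =>
      (hf.comp measurable_fin_cons).comp measurable_prodMk_right
    set h : (Fin n → Ω) → ℝ := fun S => ∫ x, f (Fin.cons x S) ∂D with hh
    have hm : Measurable h :=
      (StronglyMeasurable.integral_prod_left
        (f := fun x S => f (Fin.cons x S))
        (hf.comp measurable_fin_cons).stronglyMeasurable).measurable
    have hhb : ∀ S, |h S| ≤ b := fun S => abs_integral_le_of_abs_le fun x => hb _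
    have hhc : ∀ S i x, |h (Function.update S i x) - h S| ≤ c := by
      intro S i x
      simp only [hh]
      rw [← integral_sub (integrable_of_measurable_of_abs_le (hfx _) fun x => hb _)
        (integrable_of_measurable_of_abs_le (hfx _) fun x => hb _)]
      refine abs_integral_le_of_abs_le fun y => ?_
      rw [Fin.cons_update]
      exact hc _ _ _
    have hI : ∫ S, f S ∂(Measure.pi fun _ => D) = ∫ S, h S ∂(Measure.pi fun _ => D) :=
      integral_pi_succ D hf hb
    set m := ∫ S, f S ∂(Measure.pi fun _ => D) with hmdef
    have hmb : |m| ≤ b := abs_integral_le_of_abs_le hb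
    have hexp : ∀ u : ℝ, |u| ≤ 2 * b → |Real.exp (l * u)| ≤ Real.exp (|l| * (2 * b)) := by
      intro u hu
      rw [abs_of_pos (Real.exp_pos _)]
      refine Real.exp_le_exp.2 ((le_abs_self _).trans ?_)
      rw [abs_mul]
      gcongr
    have hsub : ∀ u v : ℝ, |u| ≤ b → |v| ≤ b → |u - v| ≤ 2 * b := fun u v hu hv => by
      rw [abs_le] at *
      constructor <;> linarith
    rw [integral_pi_succ D (f := fun S => Real.exp (l * (f S - m)))
      (b := Real.exp (|l| * (2 * b))) (Real.measurable_exp.comp ((hf.sub_const _).const_mul _))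
      fun S => hexp _ (hsub _ _ (hb S) hmb)]
    have inner : ∀ S : Fin n → Ω, ∫ x, Real.exp (l * (f (Fin.cons x S) - m)) ∂D
        ≤ Real.exp (c ^ 2 * l ^ 2 / 2) * Real.exp (l * (h S - m)) := by
      intro S
      obtain ⟨x₀⟩ : Nonempty Ω := nonempty_of_isProbabilityMeasure D
      -- The interval is centred at the value at an arbitrary point and so has length `2 * c`; this
      -- loses a factor `4` in the variance proxy.
      have hsg := ProbabilityTheory.hasSubgaussianMGF_of_mem_Icc (μ := D)
        (X := fun x => f (Fin.cons x S)) (a := f (Fin.cons x₀ S) - c)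
        (b := f (Fin.cons x₀ S) + c) (hfx S).aemeasurable (.of_forall fun x => by
          have := hc (Fin.cons x₀ S) 0 x
          rw [Fin.update_cons_zero, abs_le] at this
          constructor <;> linarith)
      have h1 := hsg.mgf_le l
      have h2 : ((((‖(f (Fin.cons x₀ S) + c) - (f (Fin.cons x₀ S) - c)‖₊ / 2) ^ 2 : ℝ≥0)) : ℝ)
          = c ^ 2 := by
        push_cast
        rw [Real.norm_eq_abs, show (f (Fin.cons x₀ S) + c) - (f (Fin.cons x₀ S) - c) = 2 * c by
          ring, abs_of_nonneg (by positivity)]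
        ring
      rw [h2] at h1
      have h3 : ∀ x, Real.exp (l * (f (Fin.cons x S) - m))
          = Real.exp (l * (f (Fin.cons x S) - h S)) * Real.exp (l * (h S - m)) := fun x => by
        rw [← Real.exp_add]; ring_nf
      simp only [h3]
      rw [integral_mul_const]
      gcongr
      exact h1
    calc _ ≤ ∫ S, Real.exp (c ^ 2 * l ^ 2 / 2) * Real.exp (l * (h S - m))
          ∂(Measure.pi fun _ : Fin n => D) := by
          refine integral_mono_of_nonneg
            (.of_forall fun S => integral_nonneg fun x => (Real.exp_pos _).le) ?_
            (.of_forall inner)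
          refine (integrable_of_measurable_of_abs_le
            (Real.measurable_exp.comp ((hm.sub_const _).const_mul _))
            fun S => hexp _ (hsub _ _ (hhb S) hmb)).const_mul _
      _ ≤ Real.exp (c ^ 2 * l ^ 2 / 2) * Real.exp (n * (c ^ 2 * l ^ 2 / 2)) := by
          rw [integral_const_mul, hI]
          gcongr
          exact ih h hm hhb hhc
      _ = _ := by rw [← Real.exp_add]; push_cast; ring_nf

/-- **McDiarmid's inequality** (with a suboptimal constant), as a subgaussian bound. -/
lemma hasSubgaussianMGF_of_bounded_differences {n : ℕ} {f : (Fin n → Ω) → ℝ} (c : ℝ≥0) {b : ℝ}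
    (hf : Measurable f) (hb : ∀ S, |f S| ≤ b)
    (hc : ∀ S i x, |f (Function.update S i x) - f S| ≤ c) :
    ProbabilityTheory.HasSubgaussianMGF
      (fun S => f S - ∫ S', f S' ∂(Measure.pi fun _ => D)) (n * c ^ 2)
      (Measure.pi fun _ => D) where
  integrable_exp_mul l := by
    refine integrable_of_measurable_of_abs_le (b := Real.exp (|l| * (b + b)))
      (Real.measurable_exp.comp ((hf.sub_const _).const_mul _)) fun S => ?_
    rw [abs_of_pos (Real.exp_pos _)]
    refine Real.exp_le_exp.2 ((le_abs_self _).trans ?_)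
    rw [abs_mul]
    gcongr
    exact (abs_sub _ _).trans (add_le_add (hb S) (abs_integral_le_of_abs_le hb))
  mgf_le l := by
    refine (integral_exp_le_of_bounded_differences D l c.coe_nonneg b n f hf hb hc).trans (le_of_eq ?_)
    push_cast
    congr 1
    ring

end BoundedDifferences

/-! ### Symmetrization and uniform deviations over a countable class. -/

section Symmetrization

lemma abs_iSup_signSum_le {Ω : Type*} {g : ℕ → Ω → ℝ} {n : ℕ}
    (h01 : ∀ j x, g j x ∈ Set.Icc (0 : ℝ) 1) (e : Fin n → Bool) (S : Fin n → Ω) :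
    |⨆ j, signSum e fun i => g j (S i)| ≤ n := by
  refine abs_ciSup_le_of_abs_le fun j => ?_
  refine (abs_signSum_le e (c := 1) fun i => ?_).trans (by simp)
  have := h01 j (S i)
  exact abs_le.2 ⟨by linarith [this.1], this.2⟩

lemma sum_mem_Icc {Ω : Type*} {g : ℕ → Ω → ℝ} {n : ℕ}
    (h01 : ∀ j x, g j x ∈ Set.Icc (0 : ℝ) 1) (j : ℕ) (S : Fin n → Ω) :
    ∑ i, g j (S i) ∈ Set.Icc (0 : ℝ) n :=
  ⟨Finset.sum_nonneg fun i _ => (h01 j _).1,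
    (Finset.sum_le_sum fun i _ => (h01 j (S i)).2).trans (by simp)⟩

lemma abs_rad_le {Ω : Type*} {g : ℕ → Ω → ℝ} {n : ℕ}
    (h01 : ∀ j x, g j x ∈ Set.Icc (0 : ℝ) 1) (S : Fin n → Ω) :
    |rad fun j i => g j (S i)| ≤ n := by
  have h := fun e => abs_le.1 (abs_iSup_signSum_le h01 e S)
  refine abs_le.2 ⟨?_, ?_⟩
  · exact (signAvg_const _).ge.trans (signAvg_mono fun e => (h e).1)
  · exact (signAvg_mono fun e => (h e).2).trans (signAvg_const _).le

/-- The supremum of the deviations of the empirical sums from their expectations. -/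
noncomputable def supDeviation {Ω : Type*} [MeasurableSpace Ω] {n : ℕ} (D : Measure Ω)
    (g : ℕ → Ω → ℝ) (S : Fin n → Ω) : ℝ :=
  ⨆ j, (n * ∫ x, g j x ∂D - ∑ i, g j (S i))

lemma measurable_supDeviation {Ω : Type*} [MeasurableSpace Ω] (D : Measure Ω)
    {g : ℕ → Ω → ℝ} {n : ℕ} (hg : ∀ j, Measurable (g j)) :
    Measurable (supDeviation D g : (Fin n → Ω) → ℝ) :=
  Measurable.iSup fun j => (Finset.measurable_sum _ fun i _ =>
    (hg j).comp (measurable_pi_apply i)).const_sub _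

variable {Ω : Type*} [MeasurableSpace Ω] (D : Measure Ω) [IsProbabilityMeasure D]
  {g : ℕ → Ω → ℝ} {n : ℕ}

lemma measurable_iSup_signSum (hg : ∀ j, Measurable (g j)) (e : Fin n → Bool) :
    Measurable fun S : Fin n → Ω => ⨆ j, signSum e fun i => g j (S i) :=
  Measurable.iSup fun j => Finset.measurable_sum _ fun i _ =>
    ((hg j).comp (measurable_pi_apply i)).const_mul _

lemma integral_comp_pi_eval {f : Ω → ℝ} (hf : Measurable f) (i : Fin n) :
    ∫ S : Fin n → Ω, f (S i) ∂(Measure.pi fun _ => D) = ∫ x, f x ∂D := by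
  have h := measurePreserving_eval (fun _ : Fin n => D) i
  conv_rhs => rw [← h.map_eq]
  rw [integral_map h.measurable.aemeasurable hf.aestronglyMeasurable]

lemma integral_mem_Icc (hg : ∀ j, Measurable (g j)) (h01 : ∀ j x, g j x ∈ Set.Icc (0 : ℝ) 1)
    (j : ℕ) : ∫ x, g j x ∂D ∈ Set.Icc (0 : ℝ) 1 :=
  ⟨integral_nonneg fun x => (h01 j x).1, by
    have h := integral_mono (μ := D)
      (Integrable.of_mem_Icc 0 1 (hg j).aemeasurable (.of_forall (h01 j)))
      (integrable_const (1 : ℝ)) (fun x => (h01 j x).2)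
    simpa using h⟩

lemma abs_deviation_le (hg : ∀ j, Measurable (g j)) (h01 : ∀ j x, g j x ∈ Set.Icc (0 : ℝ) 1)
    (j : ℕ) (S : Fin n → Ω) : |n * ∫ x, g j x ∂D - ∑ i, g j (S i)| ≤ n := by
  have h1 := sum_mem_Icc h01 j S
  have h2 := integral_mem_Icc D hg h01 j
  have h3 : (n : ℝ) * ∫ x, g j x ∂D ≤ n * 1 := by gcongr; exact h2.2
  have h4 : 0 ≤ (n : ℝ) * ∫ x, g j x ∂D := mul_nonneg (by positivity) h2.1
  exact abs_le.2 ⟨by linarith [h1.2], by linarith [h1.1]⟩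

lemma measurable_rad (hg : ∀ j, Measurable (g j)) :
    Measurable fun S : Fin n → Ω => rad fun j i => g j (S i) :=
  (Finset.measurable_sum _ fun e _ => measurable_iSup_signSum hg e).div_const _

/-- Exchanging the two components of a pair of samples at the coordinates with negative sign. -/
lemma exists_measurePreserving_swap (e : Fin n → Bool) :
    ∃ Ψ : (Fin n → Ω) × (Fin n → Ω) → (Fin n → Ω) × (Fin n → Ω),
      MeasurePreserving Ψ ((Measure.pi fun _ => D).prod (Measure.pi fun _ => D))
        ((Measure.pi fun _ => D).prod (Measure.pi fun _ => D)) ∧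
      ∀ p (f : Ω → ℝ), (fun i => f ((Ψ p).2 i) - f ((Ψ p).1 i))
        = fun i => signVal (e i) * (f (p.2 i) - f (p.1 i)) := by
  have h1 := measurePreserving_arrowProdEquivProdArrow Ω Ω (Fin n) (fun _ => D) (fun _ => D)
  have h2 : MeasurePreserving (fun (a : Fin n → Ω × Ω) i => if e i then a i else (a i).swap)
      (Measure.pi fun _ => D.prod D) (Measure.pi fun _ => D.prod D) :=
    measurePreserving_pi (fun _ => D.prod D) (fun _ => D.prod D)
      (f := fun i q => if e i then q else q.swap) fun i => by
        by_cases h : e i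
        · simp only [h, if_true]
          exact MeasurePreserving.id _
        · simpa [h] using Measure.measurePreserving_swap
  refine ⟨_, (h1.comp h2).comp h1.symm, fun p f => ?_⟩
  funext i
  by_cases h : e i <;>
    simp [h, signVal, MeasurableEquiv.arrowProdEquivProdArrow, Equiv.arrowProdEquivProdArrow]

/-- **Symmetrization**. -/
lemma integral_supDeviation_le (hg : ∀ j, Measurable (g j))
    (h01 : ∀ j x, g j x ∈ Set.Icc (0 : ℝ) 1) :
    ∫ S : Fin n → Ω, supDeviation D g S ∂(Measure.pi fun _ => D)
      ≤ 2 * ∫ S : Fin n → Ω, (rad fun j i => g j (S i)) ∂(Measure.pi fun _ => D) := by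
  set P : Measure (Fin n → Ω) := Measure.pi fun _ => D with hP
  set A : (Fin n → Bool) → ℝ := fun e => ∫ S, (⨆ j, signSum e fun i => g j (S i)) ∂P with hA
  have hAint : ∀ e, Integrable (fun S : Fin n → Ω => ⨆ j, signSum e fun i => g j (S i)) P :=
    fun e => integrable_of_measurable_of_abs_le (measurable_iSup_signSum hg e)
      (abs_iSup_signSum_le h01 e)
  set H : (Fin n → Ω) × (Fin n → Ω) → ℝ :=
    fun p => ⨆ j, ∑ i, (g j (p.2 i) - g j (p.1 i)) with hH
  have hHm : Measurable H := Measurable.iSup fun j => Finset.measurable_sum _ fun i _ =>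
    ((hg j).comp ((measurable_pi_apply i).comp measurable_snd)).sub
      ((hg j).comp ((measurable_pi_apply i).comp measurable_fst))
  have hHj : ∀ (p : (Fin n → Ω) × (Fin n → Ω)) j, |∑ i, (g j (p.2 i) - g j (p.1 i))| ≤ n := fun p j => by
    rw [Finset.sum_sub_distrib]
    have h1 := sum_mem_Icc h01 j p.1
    have h2 := sum_mem_Icc h01 j p.2
    exact abs_le.2 ⟨by linarith [h1.2, h2.1], by linarith [h1.1, h2.2]⟩
  have hHb : ∀ p, |H p| ≤ n := fun p => abs_ciSup_le_of_abs_le (hHj p)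
  have hHint : Integrable H (P.prod P) := integrable_of_measurable_of_abs_le hHm hHb
  -- The expectations are replaced by a ghost sample `p.2`; the supremum of integrals is at most the
  -- integral of the supremum.
  have step1 : ∫ S, supDeviation D g S ∂P ≤ ∫ p, H p ∂(P.prod P) := by
    rw [integral_prod _ hHint]
    refine integral_mono (integrable_of_measurable_of_abs_le (measurable_supDeviation D hg)
      fun S => abs_ciSup_le_of_abs_le fun j => abs_deviation_le D hg h01 j S)
      hHint.integral_prod_left fun S => ?_
    refine ciSup_le fun j => ?_
    have hint : ∀ i : Fin n, Integrable (fun S : Fin n → Ω => g j (S i)) P := fun i =>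
      Integrable.of_mem_Icc 0 1 ((hg j).comp (measurable_pi_apply i)).aemeasurable
        (.of_forall fun S => h01 j _)
    have hint' : ∀ i : Fin n, Integrable (fun S' : Fin n → Ω => g j (S' i) - g j (S i)) P :=
      fun i => (hint i).sub (integrable_const _)
    have h1 : ∫ S', ∑ i, (g j (S' i) - g j (S i)) ∂P
        = n * ∫ x, g j x ∂D - ∑ i, g j (S i) := by
      rw [integral_finsetSum _ fun i _ => hint' i]
      have : ∀ i, ∫ S', (g j (S' i) - g j (S i)) ∂P = ∫ x, g j x ∂D - g j (S i) := fun i => by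
        rw [integral_sub (hint i) (integrable_const _), integral_comp_pi_eval D (hg j) i]
        simp
      simp [this]
    rw [← h1]
    refine integral_mono (integrable_finsetSum _ fun i _ => hint' i)
      (integrable_of_measurable_of_abs_le (hHm.comp measurable_prodMk_left) fun S' => hHb _)
      fun S' => ?_
    exact le_ciSup (f := fun j => ∑ i, (g j (S' i) - g j (S i)))
      ⟨n, by rintro _ ⟨j, rfl⟩; exact (abs_le.1 (hHj (S, S') j)).2⟩ j
  have step2 : ∀ e, ∫ p, H p ∂(P.prod P) ≤ A e + A fun i => !e i := by
    intro e
    obtain ⟨Ψ, hΨ, hΨ'⟩ := exists_measurePreserving_swap D (n := n) e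
    have hfst := measurePreserving_fst (μ := P) (ν := P)
    have hsnd := measurePreserving_snd (μ := P) (ν := P)
    have h1 : ∫ p, H p ∂(P.prod P) = ∫ p, H (Ψ p) ∂(P.prod P) := by
      conv_lhs => rw [← hΨ.map_eq]
      rw [integral_map hΨ.measurable.aemeasurable hHm.aestronglyMeasurable]
    have h2 : A e = ∫ p : (Fin n → Ω) × (Fin n → Ω),
        (⨆ j, signSum e fun i => g j (p.2 i)) ∂(P.prod P) := by
      simp only [hA]
      rw [← hsnd.map_eq, integral_map hsnd.measurable.aemeasurable]
      · rw [hsnd.map_eq]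
      · exact (measurable_iSup_signSum hg e).aestronglyMeasurable
    have h3 : (A fun i => !e i) = ∫ p : (Fin n → Ω) × (Fin n → Ω),
        (⨆ j, signSum (fun i => !e i) fun i => g j (p.1 i)) ∂(P.prod P) := by
      simp only [hA]
      rw [← hfst.map_eq, integral_map hfst.measurable.aemeasurable]
      · rw [hfst.map_eq]
      · exact (measurable_iSup_signSum hg _).aestronglyMeasurable
    rw [h1, h2, h3, ← integral_add]
    · refine integral_mono (hΨ.integrable_comp_of_integrable hHint) ?_ fun p => ?_
      · exact (hsnd.integrable_comp_of_integrable (hAint e)).add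
          (hfst.integrable_comp_of_integrable (hAint _))
      · refine ciSup_le fun j => ?_
        have h4 : ∑ i, (g j ((Ψ p).2 i) - g j ((Ψ p).1 i))
            = signSum e (fun i => g j (p.2 i)) + signSum (fun i => !e i) fun i => g j (p.1 i) := by
          rw [signSum_not, ← sub_eq_add_neg, ← signSum_sub]
          exact Finset.sum_congr rfl fun i _ => congrFun (hΨ' p (g j)) i
        rw [h4]
        have hb : ∀ j x, |g j x| ≤ 1 := fun j x =>
          abs_le.2 ⟨by linarith [(h01 j x).1], (h01 j x).2⟩
        exact add_le_add
          (le_ciSup (bddAbove_range_signSum (fun j i => hb j (p.2 i)) e) j)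
          (le_ciSup (bddAbove_range_signSum (fun j i => hb j (p.1 i)) fun i => !e i) j)
    · exact hsnd.integrable_comp_of_integrable (hAint e)
    · exact hfst.integrable_comp_of_integrable (hAint _)
  have step3 : ∫ S, (rad fun j i => g j (S i)) ∂P = signAvg A := by
    simp only [rad, signAvg]
    rw [integral_div, integral_finsetSum _ fun e _ => hAint e]
  have step4 : ∫ p, H p ∂(P.prod P) ≤ signAvg A + signAvg A := by
    calc _ = signAvg (n := n) (fun _ => ∫ p, H p ∂(P.prod P)) := (signAvg_const _).symm
      _ ≤ signAvg (fun e => A e + A fun i => !e i) := signAvg_mono step2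
      _ = _ := by rw [signAvg_add, signAvg_not A]
  rw [step3]
  linarith

/-- A uniform deviation bound with the empirical Rademacher average of the sample. -/
lemma exists_event_deviation_le (hg : ∀ j, Measurable (g j))
    (h01 : ∀ j x, g j x ∈ Set.Icc (0 : ℝ) 1) (hn : 0 < n) {δ : ℝ} (hδ0 : 0 < δ) (hδ1 : δ < 1) :
    ∃ E : Set (Fin n → Ω), MeasurableSet E ∧ 1 - δ ≤ (Measure.pi fun _ : Fin n => D).real E ∧
      ∀ S ∈ E, ∀ j, ∫ x, g j x ∂D - (1 / (n : ℝ)) * ∑ i, g j (S i)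
        ≤ 2 * (rad fun j i => g j (S i)) / n + 5 * √(Real.log (1 / δ) / n) := by
  set P : Measure (Fin n → Ω) := Measure.pi fun _ => D with hP
  -- Concentrating the difference itself needs only one use of McDiarmid. Its mean is at most `0` by
  -- symmetrization, and changing one point moves it by at most `1 + 2 * 1 = 3`.
  set G : (Fin n → Ω) → ℝ := fun S => supDeviation D g S - 2 * rad fun j i => g j (S i) with hG
  have hGm : Measurable G := (measurable_supDeviation D hg).sub ((measurable_rad hg).const_mul _)
  have hF : ∀ S : Fin n → Ω, |supDeviation D g S| ≤ n := fun S =>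
    abs_ciSup_le_of_abs_le fun j => abs_deviation_le D hg h01 j S
  have hGb : ∀ S, |G S| ≤ n + 2 * n := fun S => by
    refine (abs_sub _ _).trans (add_le_add (hF S) ?_)
    rw [abs_mul, abs_two]
    exact mul_le_mul_of_nonneg_left (abs_rad_le h01 S) zero_le_two
  have hone : ∀ j x y, |g j x - g j y| ≤ 1 := fun j x y => by
    have h1 := h01 j x
    have h2 := h01 j y
    exact abs_le.2 ⟨by linarith [h1.1, h2.2], by linarith [h1.2, h2.1]⟩
  have hupd : ∀ (S : Fin n → Ω) k x j i, i ≠ k →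
      g j (Function.update S k x i) = g j (S i) := fun S k x j i h => by
    rw [Function.update_of_ne h]
  have hsign : ∀ (S : Fin n → Ω) k x (w : Fin n → ℝ), (∀ i, |w i| ≤ 1) → ∀ j,
      |∑ i, w i * g j (Function.update S k x i) - ∑ i, w i * g j (S i)| ≤ 1 := by
    intro S k x w hw j
    rw [← Finset.sum_sub_distrib, Finset.sum_eq_single k]
    · rw [← mul_sub, abs_mul]
      exact mul_le_one₀ (hw k) (abs_nonneg _) (hone _ _ _)
    · intro i _ hi
      rw [hupd _ _ _ _ _ hi, sub_self]
    · simp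
  have hb : ∀ j x, |g j x| ≤ 1 := fun j x =>
    abs_le.2 ⟨by linarith [(h01 j x).1], (h01 j x).2⟩
  have hGc : ∀ S i x, |G (Function.update S i x) - G S| ≤ (3 : ℝ≥0) := by
    intro S k x
    have h1 : |supDeviation D g (Function.update S k x) - supDeviation D g S| ≤ 1 := by
      have hbdd : ∀ S : Fin n → Ω,
          BddAbove (Set.range fun j => n * ∫ x, g j x ∂D - ∑ i, g j (S i)) := fun S =>
        ⟨n, by rintro _ ⟨j, rfl⟩; exact (abs_le.1 (abs_deviation_le D hg h01 j S)).2⟩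
      refine abs_ciSup_sub_ciSup_le (hbdd _) (hbdd _) fun j => ?_
      have := hsign S k x (fun _ => 1) (by simp) j
      simp only [one_mul] at this
      rw [abs_sub_comm] at this
      rwa [sub_sub_sub_cancel_left]
    have h2 : ∀ e, |(⨆ j, signSum e fun i => g j (Function.update S k x i))
        - ⨆ j, signSum e fun i => g j (S i)| ≤ 1 := fun e =>
      abs_ciSup_sub_ciSup_le (bddAbove_range_signSum (fun j i => hb j _) e)
        (bddAbove_range_signSum (fun j i => hb j _) e)
        fun j => hsign S k x (fun i => signVal (e i)) (fun i => (abs_signVal _).le) j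
    have h3 : (rad fun j i => g j (Function.update S k x i))
        ≤ (rad fun j i => g j (S i)) + 1 := by
      refine (signAvg_mono (g := fun e => (⨆ j, signSum e fun i => g j (S i)) + 1)
        fun e => ?_).trans (by rw [signAvg_add, signAvg_const]; rfl)
      linarith [(abs_le.1 (h2 e)).2]
    have h4 : (rad fun j i => g j (S i))
        ≤ (rad fun j i => g j (Function.update S k x i)) + 1 := by
      refine (signAvg_mono
        (g := fun e => (⨆ j, signSum e fun i => g j (Function.update S k x i)) + 1)
        fun e => ?_).trans (by rw [signAvg_add, signAvg_const]; rfl)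
      linarith [(abs_le.1 (h2 e)).1]
    have h5 := abs_le.1 h1
    simp only [hG, NNReal.coe_ofNat]
    exact abs_le.2 ⟨by linarith [h5.1], by linarith [h5.2]⟩
  have hEG : ∫ S, G S ∂P ≤ 0 := by
    simp only [hG]
    rw [integral_sub (integrable_of_measurable_of_abs_le (measurable_supDeviation D hg) hF)
      ((integrable_of_measurable_of_abs_le (measurable_rad hg) (abs_rad_le h01)).const_mul 2),
      integral_const_mul]
    linarith [integral_supDeviation_le D (n := n) hg h01]
  have hl : 0 < Real.log (1 / δ) := Real.log_pos (by rw [lt_div_iff₀ hδ0]; linarith)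
  have hn' : (0 : ℝ) < n := by exact_mod_cast hn
  -- Chosen so that the tail `exp (-t ^ 2 / (2 * (n * 3 ^ 2)))` equals `δ`; the final `5` comes from
  -- `18 ≤ 5 ^ 2`.
  set t : ℝ := √(18 * n * Real.log (1 / δ)) with ht
  have ht2 : t ^ 2 = 18 * n * Real.log (1 / δ) := Real.sq_sqrt (by positivity)
  have htail := (hasSubgaussianMGF_of_bounded_differences D 3 hGm hGb hGc).measure_ge_le
    (ε := t) (by positivity)
  have htail' : P.real {S | t ≤ G S} ≤ δ := by
    refine (measureReal_mono fun S hS => ?_).trans (htail.trans (le_of_eq ?_))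
    · simp only [Set.mem_ofPred_eq] at hS ⊢
      linarith
    · push_cast
      rw [ht2, show -(18 * n * Real.log (1 / δ)) / (2 * (n * 3 ^ 2)) = -Real.log (1 / δ) by
        field_simp; norm_num]
      rw [Real.log_div one_ne_zero hδ0.ne', Real.log_one, zero_sub, neg_neg, Real.exp_log hδ0]
  have hEm : MeasurableSet {S | t ≤ G S} := measurableSet_le measurable_const hGm
  refine ⟨{S | t ≤ G S}ᶜ, hEm.compl, ?_, fun S hS j => ?_⟩
  · rw [probReal_compl_eq_one_sub hEm]
    linarith
  · simp only [Set.mem_compl_iff, Set.mem_ofPred_eq, not_le] at hS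
    have h1 : n * ∫ x, g j x ∂D - ∑ i, g j (S i) ≤ supDeviation D g S :=
      le_ciSup (f := fun j => n * ∫ x, g j x ∂D - ∑ i, g j (S i))
        ⟨n, by rintro _ ⟨j, rfl⟩; exact (abs_le.1 (abs_deviation_le D hg h01 j S)).2⟩ j
    have h2 : t / n ≤ 5 * √(Real.log (1 / δ) / n) := by
      rw [div_le_iff₀ hn', ht]
      apply Real.sqrt_le_iff.2 ⟨by positivity, ?_⟩
      rw [mul_pow, mul_pow, Real.sq_sqrt (by positivity)]
      field_simp
      norm_num
    have h3 : n * ∫ x, g j x ∂D - ∑ i, g j (S i) ≤ 2 * (rad fun j i => g j (S i)) + t := by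
      simp only [hG] at hS
      linarith
    calc _ = (n * ∫ x, g j x ∂D - ∑ i, g j (S i)) / n := by field_simp
      _ ≤ (2 * (rad fun j i => g j (S i)) + t) / n := by gcongr
      _ = 2 * (rad fun j i => g j (S i)) / n + t / n := by ring
      _ ≤ _ := by gcongr

end Symmetrization

/-! ### Sparse approximation of matrices in an `ℓ¹` ball. -/

section Sparsification

variable {p q : ℕ}

/-- The squared Frobenius norm of a matrix. -/
noncomputable def frobSq (A : Matrix (Fin p) (Fin q) ℝ) : ℝ := ∑ i, ∑ j, A i j ^ 2

lemma frobSq_nonneg (A : Matrix (Fin p) (Fin q) ℝ) : 0 ≤ frobSq A :=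
  Finset.sum_nonneg fun _ _ => Finset.sum_nonneg fun _ _ => sq_nonneg _

lemma frobSq_smul (c : ℝ) (A : Matrix (Fin p) (Fin q) ℝ) : frobSq (c • A) = c ^ 2 * frobSq A := by
  simp [frobSq, Finset.mul_sum, mul_pow]

lemma frobSq_add (A A' : Matrix (Fin p) (Fin q) ℝ) :
    frobSq (A + A') = frobSq A + 2 * (∑ i, ∑ j, A i j * A' i j) + frobSq A' := by
  simp only [frobSq, Finset.mul_sum, ← Finset.sum_add_distrib]
  exact Finset.sum_congr rfl fun i _ => Finset.sum_congr rfl fun j _ => by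
    simp only [Matrix.add_apply]; ring

lemma frobSq_sub_le (A A' : Matrix (Fin p) (Fin q) ℝ) :
    frobSq (A - A') ≤ 2 * frobSq A + 2 * frobSq A' := by
  simp only [frobSq, Finset.mul_sum, ← Finset.sum_add_distrib]
  exact Finset.sum_le_sum fun i _ => Finset.sum_le_sum fun j _ => by
    simp only [Matrix.sub_apply]
    nlinarith [sq_nonneg (A i j + A' i j)]

lemma frobSq_le_of_entrywiseL1_le {A : Matrix (Fin p) (Fin q) ℝ} {a : ℝ}
    (h : entrywiseL1 A ≤ a) : frobSq A ≤ a ^ 2 := by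
  have h0 : 0 ≤ entrywiseL1 A :=
    Finset.sum_nonneg fun _ _ => Finset.sum_nonneg fun _ _ => abs_nonneg _
  refine le_trans ?_ (pow_le_pow_left₀ h0 h 2)
  unfold frobSq entrywiseL1
  rw [← Finset.sum_product', ← Finset.sum_product']
  refine le_trans (le_of_eq ?_) (Finset.sum_sq_le_sq_sum_of_nonneg fun x _ => abs_nonneg _)
  exact Finset.sum_congr rfl fun x _ => (sq_abs _).symm

/-- The matrix with the single nonzero entry `± a` at a given position; zero if the position lies
outside the range of indices. -/
noncomputable def atom (p q : ℕ) {M : ℕ} (a : ℝ) (x : Fin M × Fin M × Bool) :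
    Matrix (Fin p) (Fin q) ℝ :=
  fun i j => if (i : ℕ) = x.1 ∧ (j : ℕ) = x.2.1 then signVal x.2.2 * a else 0

lemma frobSq_atom_le {M : ℕ} (a : ℝ) (x : Fin M × Fin M × Bool) :
    frobSq (atom p q a x) ≤ a ^ 2 := by
  have hs : signVal x.2.2 ^ 2 = 1 := by rw [← sq_abs, abs_signVal, one_pow]
  by_cases h : (x.1 : ℕ) < p ∧ (x.2.1 : ℕ) < q
  · unfold frobSq
    rw [Finset.sum_eq_single ⟨x.1, h.1⟩, Finset.sum_eq_single ⟨x.2.1, h.2⟩]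
    · simp [atom, mul_pow, hs]
    · intro j _ hj
      have : (j : ℕ) ≠ x.2.1 := fun h' => hj (Fin.ext h')
      simp [atom, this]
    · simp
    · intro i _ hi
      have : (i : ℕ) ≠ x.1 := fun h' => hi (Fin.ext h')
      simp [atom, this]
    · simp
  · have : ∀ i j, atom p q a x i j = 0 := fun i j => by
      refine if_neg fun h' => h ⟨?_, ?_⟩
      · rw [← h'.1]; exact i.2
      · rw [← h'.2]; exact j.2
    simp [frobSq, this, sq_nonneg]

/-- A matrix in an `ℓ¹` ball is dominated, in any direction, by an extreme point of the ball. -/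
lemma exists_atom_inner_le {M : ℕ} (hM : 0 < M) (hp : p ≤ M) (hq : q ≤ M) {a : ℝ}
    (e : Matrix (Fin p) (Fin q) ℝ) {W : Matrix (Fin p) (Fin q) ℝ} (hW : entrywiseL1 W ≤ a) :
    ∃ x : Fin M × Fin M × Bool, ∑ i, ∑ j, e i j * (W - atom p q a x) i j ≤ 0 := by
  rcases isEmpty_or_nonempty (Fin p × Fin q) with h | h
  · refine ⟨(⟨0, hM⟩, ⟨0, hM⟩, true), le_of_eq ?_⟩
    exact Finset.sum_eq_zero fun i _ => Finset.sum_eq_zero fun j _ => (h.false (i, j)).elim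
  · obtain ⟨⟨i₀, j₀⟩, h0⟩ := Finite.exists_max fun x : Fin p × Fin q => |e x.1 x.2|
    refine ⟨(i₀.castLE hp, j₀.castLE hq, decide (0 ≤ e i₀ j₀)), ?_⟩
    have h1 : ∑ i, ∑ j, e i j * W i j ≤ |e i₀ j₀| * a := by
      calc _ ≤ ∑ i, ∑ j, |e i₀ j₀| * |W i j| :=
            Finset.sum_le_sum fun i _ => Finset.sum_le_sum fun j _ => by
              refine (le_abs_self _).trans ?_
              rw [abs_mul]
              exact mul_le_mul_of_nonneg_right (h0 (i, j)) (abs_nonneg _)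
        _ = |e i₀ j₀| * entrywiseL1 W := by simp [entrywiseL1, Finset.mul_sum]
        _ ≤ _ := by gcongr
    have h2 : ∑ i, ∑ j, e i j * atom p q a
        (i₀.castLE hp, j₀.castLE hq, decide (0 ≤ e i₀ j₀)) i j = |e i₀ j₀| * a := by
      rw [Finset.sum_eq_single i₀, Finset.sum_eq_single j₀]
      · by_cases he : 0 ≤ e i₀ j₀
        · simp [atom, signVal, he, abs_of_nonneg he]
        · simp [atom, signVal, he, abs_of_neg (not_le.1 he)]
      · intro j _ hj
        have : (j : ℕ) ≠ j₀ := fun h' => hj (Fin.ext h')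
        simp [atom, this]
      · simp
      · intro i _ hi
        have : (i : ℕ) ≠ i₀ := fun h' => hi (Fin.ext h')
        simp [atom, this]
      · simp
    simp only [Matrix.sub_apply, mul_sub, Finset.sum_sub_distrib]
    linarith

/-- **Maurey's lemma**: matrices in an `ℓ¹` ball are close, in Frobenius norm, to averages of
extreme points of the ball. -/
lemma exists_sum_atom_frobSq_le {M : ℕ} (hM : 0 < M) (hp : p ≤ M) (hq : q ≤ M) {a : ℝ}
    {W : Matrix (Fin p) (Fin q) ℝ} (hW : entrywiseL1 W ≤ a) (k : ℕ) :
    ∃ τ : Fin k → Fin M × Fin M × Bool,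
      frobSq ((k : ℝ) • W - ∑ t, atom p q a (τ t)) ≤ k * (4 * a ^ 2) := by
  induction k with
  | zero => exact ⟨fun i => i.elim0, by simp [frobSq]⟩
  | succ k ih =>
    obtain ⟨τ, hτ⟩ := ih
    -- Greedy choice in place of random sampling: the new increment makes a nonpositive inner
    -- product with the current error, so squared norms simply add, each being at most `4 * a ^ 2`.
    obtain ⟨x, hx⟩ := exists_atom_inner_le hM hp hq ((k : ℝ) • W - ∑ t, atom p q a (τ t)) hW
    refine ⟨Fin.cons x τ, ?_⟩
    have h1 : ((k + 1 : ℕ) : ℝ) • W - ∑ t, atom p q a ((Fin.cons x τ : Fin (k + 1) → _) t)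
        = ((k : ℝ) • W - ∑ t, atom p q a (τ t)) + (W - atom p q a x) := by
      rw [Fin.sum_univ_succ]
      simp only [Fin.cons_zero, Fin.cons_succ]
      push_cast
      rw [add_smul, one_smul]
      abel
    have h2 := frobSq_sub_le W (atom p q a x)
    have h3 := frobSq_le_of_entrywiseL1_le hW
    have h4 := frobSq_atom_le (p := p) (q := q) a x
    rw [h1, frobSq_add]
    push_cast
    linarith

/-- The matrices in an `ℓ¹` ball can be encoded by `k` letters so that matrices with the same code
have Frobenius distance `O (a / √(k + 1))`. -/
lemma exists_code_frobSq_le {M : ℕ} (hM : 0 < M) (hp : p ≤ M) (hq : q ≤ M) (a : ℝ) (k : ℕ) :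
    ∃ c : Matrix (Fin p) (Fin q) ℝ → Fin k → Fin M × Fin M × Bool,
      ∀ W W', entrywiseL1 W ≤ a → entrywiseL1 W' ≤ a → c W = c W' →
        (k + 1) * frobSq (W - W') ≤ 32 * a ^ 2 := by
  have h : ∀ W : Matrix (Fin p) (Fin q) ℝ, ∃ τ : Fin k → Fin M × Fin M × Bool,
      entrywiseL1 W ≤ a → frobSq ((k : ℝ) • W - ∑ t, atom p q a (τ t)) ≤ k * (4 * a ^ 2) := by
    intro W
    by_cases hW : entrywiseL1 W ≤ a
    · obtain ⟨τ, hτ⟩ := exists_sum_atom_frobSq_le hM hp hq hW k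
      exact ⟨τ, fun _ => hτ⟩
    · exact ⟨fun _ => (⟨0, hM⟩, ⟨0, hM⟩, true), fun h => (hW h).elim⟩
  choose c hc using h
  refine ⟨c, fun W W' hW hW' hcc => ?_⟩
  -- The factor `k + 1` in the claim makes the empty code meaningful: for `k = 0` the diameter of
  -- the ball suffices.
  rcases Nat.eq_zero_or_pos k with rfl | hk
  · have h1 := frobSq_sub_le W W'
    have h2 := frobSq_le_of_entrywiseL1_le hW
    have h3 := frobSq_le_of_entrywiseL1_le hW'
    push_cast
    nlinarith [sq_nonneg a]
  · have h1 := hc W hW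
    have h2 := hc W' hW'
    rw [← hcc] at h2
    have h3 := frobSq_sub_le ((k : ℝ) • W - ∑ t, atom p q a (c W t))
      ((k : ℝ) • W' - ∑ t, atom p q a (c W t))
    rw [sub_sub_sub_cancel_right, ← smul_sub, frobSq_smul] at h3
    have hk1 : (1 : ℝ) ≤ k := by exact_mod_cast hk
    have h4 : (k : ℝ) * (k * frobSq (W - W')) ≤ k * (16 * a ^ 2) := by nlinarith
    have h5 := le_of_mul_le_mul_left h4 (by linarith)
    have h6 := frobSq_nonneg (W - W')
    nlinarith

lemma norm_toEuclideanLin_le (A : Matrix (Fin p) (Fin q) ℝ) (x : Vec q) :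
    ‖Matrix.toEuclideanLin A x‖ ≤ √(frobSq A) * ‖x‖ := by
  rw [EuclideanSpace.norm_eq, EuclideanSpace.norm_eq, ← Real.sqrt_mul (frobSq_nonneg A)]
  apply Real.sqrt_le_sqrt
  unfold frobSq
  rw [Finset.sum_mul]
  refine Finset.sum_le_sum fun i _ => ?_
  simp only [Real.norm_eq_abs, sq_abs]
  have : (Matrix.toEuclideanLin A x) i = ∑ j, A i j * x j := by
    simp [Matrix.mulVec, dotProduct]
  rw [this]
  exact Finset.sum_mul_sq_le_sq_mul_sq _ _ _

lemma norm_toEuclideanLin_le_of_matSpectralNorm_le {A : Matrix (Fin p) (Fin q) ℝ} {s : ℝ}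
    (h : matSpectralNorm A ≤ s) (x : Vec q) : ‖Matrix.toEuclideanLin A x‖ ≤ s * ‖x‖ :=
  ((LinearMap.toContinuousLinearMap (Matrix.toEuclideanLin A)).le_opNorm x).trans
    (by gcongr; exact h)

end Sparsification

/-! ### Dependence of the network on its weights. -/

section Network

variable {L : ℕ} {m : Fin (L + 1) → ℕ}

lemma filter_castSucc_lt_succ (i : Fin L) :
    (Finset.univ.filter fun l : Fin L => l.castSucc < i.succ)
      = insert i (Finset.univ.filter fun l : Fin L => l.castSucc < i.castSucc) := by
  ext l
  simp only [Finset.mem_filter, Finset.mem_univ, true_and, Finset.mem_insert, Fin.lt_def,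
    Fin.val_castSucc, Fin.val_succ, Fin.ext_iff]
  omega

lemma filter_castSucc_lt_last :
    (Finset.univ.filter fun l : Fin L => l.castSucc < Fin.last L) = Finset.univ := by
  ext l
  simp [Fin.castSucc_lt_last]

/-- The product of the layer gains `ρ_l s_l` over the layers before `i`. -/
noncomputable def gain (ρ : Fin L → ℝ≥0) (s : Fin L → ℝ) (i : Fin (L + 1)) : ℝ :=
  ∏ l ∈ Finset.univ.filter (fun l : Fin L => l.castSucc < i), (ρ l : ℝ) * s l

lemma gain_succ (ρ : Fin L → ℝ≥0) (s : Fin L → ℝ) (i : Fin L) :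
    gain ρ s i.succ = ρ i * s i * gain ρ s i.castSucc := by
  unfold gain
  rw [filter_castSucc_lt_succ, Finset.prod_insert (by simp)]

lemma gain_last (ρ : Fin L → ℝ≥0) (s : Fin L → ℝ) :
    gain ρ s (Fin.last L) = ∏ l, (ρ l : ℝ) * s l := by
  unfold gain
  rw [filter_castSucc_lt_last]

lemma layerOutput_succ (σ : Activations m) (W : Weights m) (i : Fin L) (x : Vec (m 0)) :
    layerOutput σ W i.succ x = σ i (Matrix.toEuclideanLin (W i) (layerOutput σ W i.castSucc x)) := by
  simp [layerOutput, Fin.induction_succ]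

variable {ρ : Fin L → ℝ≥0} {σ : Activations m} {s a : Fin L → ℝ}

lemma norm_layerOutput_le (hσ : ∀ i, LipschitzWith (ρ i) (σ i)) (hσ0 : ∀ i, σ i 0 = 0)
    {W : Weights m} (hW : ∀ l, matSpectralNorm (W l) ≤ s l) (x : Vec (m 0)) (i : Fin (L + 1)) :
    ‖layerOutput σ W i x‖ ≤ gain ρ s i * ‖x‖ := by
  induction i using Fin.induction with
  | zero => simp [layerOutput, gain]
  | succ i ih =>
    rw [layerOutput_succ, gain_succ]
    have h1 := (hσ i).dist_le_mul
      (Matrix.toEuclideanLin (W i) (layerOutput σ W i.castSucc x)) 0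
    rw [hσ0, dist_zero_right, dist_zero_right] at h1
    have h2 := norm_toEuclideanLin_le_of_matSpectralNorm_le (hW i)
      (layerOutput σ W i.castSucc x)
    have hs0 : 0 ≤ s i := (norm_nonneg _).trans (hW i)
    calc _ ≤ (ρ i : ℝ) * (s i * (gain ρ s i.castSucc * ‖x‖)) :=
          h1.trans (by gcongr; exact h2.trans (by gcongr))
      _ = _ := by ring

/-- The normalized distance `∑ ‖W_l - W'_l‖_F / s_l` of two weights. -/
noncomputable def weightDist (s : Fin L → ℝ) (W W' : Weights m) : ℝ :=
  ∑ l, √(frobSq (W l - W' l)) / s l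

/-- Each layer splits as `W g - W' g' = W (g - g') + (W - W') g'`. The old error is amplified by the
gain `ρ_i s_i`, and the new one, measured relative to `s_i`, carries the same gain, so relative
errors add up. -/
lemma norm_layerOutput_sub_le (hσ : ∀ i, LipschitzWith (ρ i) (σ i)) (hσ0 : ∀ i, σ i 0 = 0)
    (hs : ∀ l, 0 < s l) {W W' : Weights m} (hW : ∀ l, matSpectralNorm (W l) ≤ s l)
    (hW' : ∀ l, matSpectralNorm (W' l) ≤ s l) (x : Vec (m 0)) (i : Fin (L + 1)) :
    ‖layerOutput σ W i x - layerOutput σ W' i x‖ ≤ gain ρ s i * ‖x‖ *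
      ∑ l ∈ Finset.univ.filter (fun l : Fin L => l.castSucc < i),
        √(frobSq (W l - W' l)) / s l := by
  induction i using Fin.induction with
  | zero => simp [layerOutput]
  | succ i ih =>
    rw [layerOutput_succ, layerOutput_succ, gain_succ, filter_castSucc_lt_succ,
      Finset.sum_insert (by simp)]
    set g := layerOutput σ W i.castSucc x
    set g' := layerOutput σ W' i.castSucc x
    set R := ∑ l ∈ Finset.univ.filter (fun l : Fin L => l.castSucc < i.castSucc),
        √(frobSq (W l - W' l)) / s l
    have h1 := (hσ i).dist_le_mul (Matrix.toEuclideanLin (W i) g) (Matrix.toEuclideanLin (W' i) g')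
    rw [dist_eq_norm, dist_eq_norm] at h1
    have h2 : Matrix.toEuclideanLin (W i) g - Matrix.toEuclideanLin (W' i) g'
        = Matrix.toEuclideanLin (W i) (g - g') + Matrix.toEuclideanLin (W i - W' i) g' := by
      simp only [map_sub, LinearMap.sub_apply]
      abel
    have h3 := norm_toEuclideanLin_le_of_matSpectralNorm_le (hW i) (g - g')
    have h4 := norm_toEuclideanLin_le (W i - W' i) g'
    have h5 : ‖g'‖ ≤ gain ρ s i.castSucc * ‖x‖ := norm_layerOutput_le hσ hσ0 hW' x _
    have hsi := hs i
    calc _ ≤ (ρ i : ℝ) * (s i * (gain ρ s i.castSucc * ‖x‖ * R)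
          + √(frobSq (W i - W' i)) * (gain ρ s i.castSucc * ‖x‖)) := by
          refine h1.trans ?_
          rw [h2]
          gcongr
          refine (norm_add_le _ _).trans (add_le_add (h3.trans (by gcongr)) (h4.trans (by gcongr)))
      _ = _ := by field_simp; ring

lemma norm_net_sub_le (hσ : ∀ i, LipschitzWith (ρ i) (σ i)) (hσ0 : ∀ i, σ i 0 = 0)
    (hs : ∀ l, 0 < s l) {W W' : Weights m} (hW : ∀ l, matSpectralNorm (W l) ≤ s l)
    (hW' : ∀ l, matSpectralNorm (W' l) ≤ s l) (x : Vec (m 0)) :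
    ‖net σ W x - net σ W' x‖ ≤ (∏ l, (ρ l : ℝ) * s l) * ‖x‖ * weightDist s W W' := by
  have h := norm_layerOutput_sub_le hσ hσ0 hs hW hW' x (Fin.last L)
  rwa [gain_last, filter_castSucc_lt_last] at h

lemma continuous_net (hσ : ∀ i, LipschitzWith (ρ i) (σ i)) (x : Vec (m 0)) :
    Continuous fun W : Weights m => net σ W x := by
  suffices h : ∀ i, Continuous fun W : Weights m => layerOutput σ W i x from h _
  intro i
  induction i using Fin.induction with
  | zero => exact continuous_const
  | succ i ih =>
    simp only [layerOutput_succ]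
    refine (hσ i).continuous.comp ?_
    have h : ∀ W : Weights m, Matrix.toEuclideanLin (W i) (layerOutput σ W i.castSucc x)
        = WithLp.toLp 2 ((W i).mulVec (layerOutput σ W i.castSucc x).ofLp) := fun W => rfl
    simp only [h]
    refine (PiLp.continuous_toLp 2 _).comp ?_
    exact (continuous_apply i).matrix_mulVec ((PiLp.continuous_ofLp 2 _).comp ih)

lemma continuous_weightDist_right (W : Weights m) :
    Continuous fun W' : Weights m => weightDist s W W' := by
  unfold weightDist frobSq
  refine continuous_finsetSum _ fun l _ => (Real.continuous_sqrt.comp ?_).div_const _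
  refine continuous_finsetSum _ fun i _ => continuous_finsetSum _ fun j _ => ?_
  simp only [Matrix.sub_apply]
  exact (continuous_const.sub ((continuous_apply l).matrix_elem i j)).pow 2

lemma weightDist_self (W : Weights m) : weightDist s W W = 0 := by
  simp [weightDist, frobSq]

end Network

/-! ### Dependence of the robust loss on the weights. -/

section RobustLoss

variable {L : ℕ} {m : Fin (L + 1) → ℕ} {ρ : Fin L → ℝ≥0} {σ : Activations m} {s a : Fin L → ℝ}
  {B : Vec (m 0) → Set (Vec (m 0))} {r : ℝ≥0}
  {loss : Vec (m (Fin.last L)) → Fin (m (Fin.last L)) → ℝ}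

lemma bddAbove_range_loss (h01 : ∀ v y, loss v y ∈ Set.Icc (0 : ℝ) 1) (W : Weights m)
    (p : Example m) : BddAbove (Set.range fun x' : B p.1 => loss (net σ W x') p.2) :=
  ⟨1, by rintro _ ⟨x', rfl⟩; exact (h01 _ _).2⟩

lemma robustLoss_mem_Icc (hB : ∀ x, (B x).Nonempty) (h01 : ∀ v y, loss v y ∈ Set.Icc (0 : ℝ) 1)
    (W : Weights m) (p : Example m) : robustLoss loss B σ W p ∈ Set.Icc (0 : ℝ) 1 := by
  have := (hB p.1).to_subtype
  have x' : B p.1 := Classical.arbitrary _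
  exact ⟨(h01 _ _).1.trans (le_ciSup (bddAbove_range_loss h01 W p) x'),
    ciSup_le fun x' => (h01 _ _).2⟩

lemma abs_robustLoss_sub_le (hσ : ∀ i, LipschitzWith (ρ i) (σ i)) (hσ0 : ∀ i, σ i 0 = 0)
    (hs : ∀ l, 0 < s l) (hB : ∀ x, (B x).Nonempty) (hLip : ∀ y, LipschitzWith r fun v => loss v y)
    (h01 : ∀ v y, loss v y ∈ Set.Icc (0 : ℝ) 1) {W W' : Weights m}
    (hW : W ∈ weightClass m s a) (hW' : W' ∈ weightClass m s a) {p : Example m} {Btil : ℝ}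
    (hp : ∀ x' ∈ B p.1, ‖x'‖ ≤ Btil) :
    |robustLoss loss B σ W p - robustLoss loss B σ W' p|
      ≤ Btil * r * (∏ l, (ρ l : ℝ) * s l) * weightDist s W W' := by
  have := (hB p.1).to_subtype
  refine abs_ciSup_sub_ciSup_le (bddAbove_range_loss h01 W p) (bddAbove_range_loss h01 W' p)
    fun x' => ?_
  have h1 := (hLip p.2).dist_le_mul (net σ W x') (net σ W' x')
  rw [Real.dist_eq, dist_eq_norm] at h1
  have h2 := norm_net_sub_le hσ hσ0 hs (fun l => (hW l).1) (fun l => (hW' l).1) (x' : Vec (m 0))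
  have h3 : 0 ≤ ∏ l, (ρ l : ℝ) * s l :=
    Finset.prod_nonneg fun l _ => mul_nonneg (ρ l).2 (hs l).le
  have h4 : 0 ≤ weightDist s W W' :=
    Finset.sum_nonneg fun l _ => div_nonneg (Real.sqrt_nonneg _) (hs l).le
  calc _ ≤ (r : ℝ) * ((∏ l, (ρ l : ℝ) * s l) * Btil * weightDist s W W') :=
        h1.trans (by gcongr; exact h2.trans (by gcongr; exact hp _ x'.2))
    _ = _ := by ring

end RobustLoss

/-! ### Codes for the weight class. -/

section Entropy

variable {L : ℕ} {m : Fin (L + 1) → ℕ} {s a : Fin L → ℝ}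

/-- The entries `a_l^(2/3) / s_l^(2/3)` of the complexity sum. -/
noncomputable def layerCost (s a : Fin L → ℝ) (l : Fin L) : ℝ :=
  a l ^ (2 / 3 : ℝ) / s l ^ (2 / 3 : ℝ)

/-- With `u` the cube root of `a l / s l`, the fractional powers become natural ones. -/
lemma exists_layerCost_eq (hs : ∀ l, 0 < s l) (ha : ∀ l, 0 ≤ a l) (l : Fin L) :
    ∃ u : ℝ, 0 ≤ u ∧ layerCost s a l = u ^ 2 ∧ a l = s l * u ^ 3 := by
  have hb : 0 ≤ a l / s l := div_nonneg (ha l) (hs l).le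
  refine ⟨(a l / s l) ^ (1 / 3 : ℝ), by positivity, ?_, ?_⟩
  · rw [layerCost, ← Real.div_rpow (ha l) (hs l).le, ← Real.rpow_natCast, ← Real.rpow_mul hb]
    norm_num
  · rw [← Real.rpow_natCast, ← Real.rpow_mul hb]
    norm_num
    field_simp [(hs l).ne']

/-- The accuracy of one layer given its share of a budget `N ^ 2`: `f` is at most `32 * a ^ 2 / (k +
1)`, hence at most `64 * A * s ^ 2 * u ^ 4 / N ^ 2`. The bound is linear in the layer cost `u ^ 2`,
so it sums to `A ^ (3/2)`. -/
lemma sqrt_div_le_of_code {f s a u A k N : ℝ} (hs : 0 < s) (hu : 0 ≤ u) (ha : a = s * u ^ 3)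
    (hA : 0 ≤ A) (huA : u ^ 2 ≤ A) (hN : 0 < N) (hk0 : 0 ≤ k) (hk : N ^ 2 * u ^ 2 / (2 * A) ≤ k + 1)
    (hf : (k + 1) * f ≤ 32 * a ^ 2) : √f / s ≤ 8 * √A * (1 / N) * u ^ 2 := by
  rw [div_le_iff₀ hs]
  apply Real.sqrt_le_iff.2 ⟨by positivity, ?_⟩
  rcases hu.eq_or_lt with rfl | hu
  · subst ha
    norm_num at hf ⊢
    nlinarith
  · have hA' : 0 < A := lt_of_lt_of_le (by positivity) huA
    rw [div_le_iff₀ (by positivity)] at hk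
    have h1 : f * (N ^ 2 * u ^ 2) ≤ 64 * A * (s * u ^ 3) ^ 2 := by
      rcases le_total f 0 with h | h
      · exact (mul_nonpos_of_nonpos_of_nonneg h (by positivity)).trans (by positivity)
      · calc f * (N ^ 2 * u ^ 2) ≤ f * ((k + 1) * (2 * A)) := by gcongr
          _ = (k + 1) * f * (2 * A) := by ring
          _ ≤ 32 * a ^ 2 * (2 * A) := by gcongr
          _ = _ := by rw [ha]; ring
    have h2 : (8 * √A * (1 / N) * u ^ 2 * s) ^ 2 = 64 * A * (s * u ^ 3) ^ 2 / (N ^ 2 * u ^ 2) := by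
      rw [show (8 * √A * (1 / N) * u ^ 2 * s) ^ 2 = 64 * (√A) ^ 2 * (1 / N) ^ 2 * (u ^ 2 * s) ^ 2 by
        ring, Real.sq_sqrt hA]
      field_simp
    rw [h2, le_div_iff₀ (by positivity)]
    exact h1

/-- Encoding the weight class at all dyadic scales. -/
lemma exists_codes_weightDist_le (hm : 0 < maxWidth m) (hs : ∀ l, 0 < s l) (ha : ∀ l, 0 ≤ a l) :
    ∃ (k : ℕ → Fin L → ℕ)
      (c : ∀ j, Weights m → ∀ l, Fin (k j l) → Fin (maxWidth m) × Fin (maxWidth m) × Bool),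
      (∀ l, k 0 l = 0) ∧ (∀ j, ((∑ l, k j l : ℕ) : ℝ) ≤ 4 ^ j) ∧
      ∀ j, ∀ W ∈ weightClass m s a, ∀ W' ∈ weightClass m s a, c j W = c j W' →
        weightDist s W W' ≤ 8 * (∑ l, layerCost s a l) ^ (3 / 2 : ℝ) * (1 / 2) ^ j := by
  set A := ∑ l, layerCost s a l with hA
  have hcost : ∀ l, 0 ≤ layerCost s a l := fun l =>
    div_nonneg (Real.rpow_nonneg (ha l) _) (Real.rpow_nonneg (hs l).le _)
  have hA0 : 0 ≤ A := Finset.sum_nonneg fun l _ => hcost l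
  have hleA : ∀ l, layerCost s a l ≤ A := fun l =>
    Finset.single_le_sum (fun l _ => hcost l) (Finset.mem_univ l)
  have hhalf : ∀ l, layerCost s a l / (2 * A) ≤ 1 / 2 := fun l => by
    rcases hA0.eq_or_lt with h | h
    · rw [← h]; norm_num
    · rw [div_le_iff₀ (by positivity)]
      linarith [hleA l]
  -- The factor `2` keeps every share below `1` at `j = 0`, so no letters are used there, even with
  -- a single layer. If `A = 0`, division by zero also gives no letters, as it should.
  set k : ℕ → Fin L → ℕ := fun j l => ⌊(4 : ℝ) ^ j * layerCost s a l / (2 * A)⌋₊ with hk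
  have hcode := fun j l => exists_code_frobSq_le hm
    (Finset.le_sup (f := m) (Finset.mem_univ (Fin.succ l)))
    (Finset.le_sup (f := m) (Finset.mem_univ (Fin.castSucc l))) (a l) (k j l)
  choose c hc using hcode
  refine ⟨k, fun j W l => c j l (W l), fun l => ?_, fun j => ?_, fun j W hW W' hW' h => ?_⟩
  · refine Nat.floor_eq_zero.2 ?_
    rw [pow_zero, one_mul]
    linarith [hhalf l]
  · push_cast
    calc ∑ l, (k j l : ℝ) ≤ ∑ l, (4 : ℝ) ^ j * layerCost s a l / (2 * A) :=
          Finset.sum_le_sum fun l _ => Nat.floor_le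
            (div_nonneg (mul_nonneg (by positivity) (hcost l)) (by positivity))
      _ = 4 ^ j * (A / (2 * A)) := by
          rw [← Finset.sum_div, ← Finset.mul_sum, mul_div_assoc]
      _ ≤ 4 ^ j * 1 := by
          gcongr
          rcases hA0.eq_or_lt with h | h
          · rw [← h]; norm_num
          · rw [div_le_one (by positivity)]; linarith
      _ = 4 ^ j := mul_one _
  · have hA32 : A ^ (3 / 2 : ℝ) = √A * A := by
      rw [Real.sqrt_eq_rpow]
      conv_rhs => rw [← Real.rpow_one A, ← Real.rpow_mul hA0]
      rcases hA0.eq_or_lt with h | h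
      · rw [← h, Real.zero_rpow (by norm_num), Real.zero_rpow (by norm_num), zero_mul]
      · rw [← Real.rpow_add h]; norm_num
    have hl : ∀ l, √(frobSq (W l - W' l)) / s l
        ≤ 8 * √A * (1 / 2) ^ j * layerCost s a l := by
      intro l
      obtain ⟨u, hu, hu2, hu3⟩ := exists_layerCost_eq hs ha l
      have h4 : ((2 : ℝ) ^ j) ^ 2 = 4 ^ j := by rw [← pow_mul, mul_comm, pow_mul]; norm_num
      rw [hu2, one_div_pow]
      refine sqrt_div_le_of_code (k := k j l) (hs l) hu hu3 hA0 (hu2 ▸ hleA l) (by positivity)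
        (by positivity) ?_ (hc j l _ _ (hW l).2 (hW' l).2 (congrFun h l))
      rw [h4, ← hu2]
      exact (Nat.lt_floor_add_one _).le
    calc weightDist s W W' ≤ ∑ l, 8 * √A * (1 / 2) ^ j * layerCost s a l :=
          Finset.sum_le_sum fun l _ => hl l
      _ = _ := by rw [← Finset.mul_sum, hA32]; ring

end Entropy

/-! ### The Rademacher average of the robust losses. -/

section Complexity

variable {L : ℕ} {m : Fin (L + 1) → ℕ} {ρ : Fin L → ℝ≥0} {σ : Activations m} {s a : Fin L → ℝ}
  {B : Vec (m 0) → Set (Vec (m 0))} {r : ℝ≥0}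
  {loss : Vec (m (Fin.last L)) → Fin (m (Fin.last L)) → ℝ}

/-- The Rademacher average of robust losses on a sample with bounded perturbation sets. -/
lemma rad_robustLoss_le (hσ : ∀ i, LipschitzWith (ρ i) (σ i)) (hσ0 : ∀ i, σ i 0 = 0)
    (hs : ∀ l, 0 < s l) (ha : ∀ l, 0 ≤ a l) (hB : ∀ x, (B x).Nonempty)
    (hLip : ∀ y, LipschitzWith r fun v => loss v y)
    (h01 : ∀ v y, loss v y ∈ Set.Icc (0 : ℝ) 1) (hm : 0 < maxWidth m)
    {T : Type*} [Nonempty T] {w : T → Weights m} (hw : ∀ t, w t ∈ weightClass m s a)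
    {n : ℕ} (hn : 0 < n) {S : Fin n → Example m} {Btil : ℝ} (hBtil : 0 ≤ Btil)
    (hS : BoundsAdversarial B S Btil) :
    2 * (rad fun t i => robustLoss loss B σ (w t) (S i)) / n
      ≤ 288 * (logFactor n (maxWidth m) * leadingTerm n Btil r (fun i => (ρ i : ℝ)) s a) := by
  set M := maxWidth m with hM
  obtain ⟨k, c, hk0, hk, hc⟩ := exists_codes_weightDist_le hm hs ha
  have hM1 : (1 : ℝ) ≤ M := by exact_mod_cast hm
  have hn' : (0 : ℝ) < n := by exact_mod_cast hn
  have h2M : (2 : ℝ) ≤ 2 * (M : ℝ) ^ 2 := by nlinarith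
  have hprod : 0 ≤ ∏ l, (ρ l : ℝ) * s l :=
    Finset.prod_nonneg fun l _ => mul_nonneg (ρ l).2 (hs l).le
  have hA0 : 0 ≤ ∑ l, layerCost s a l := Finset.sum_nonneg fun l _ =>
    div_nonneg (Real.rpow_nonneg (ha l) _) (Real.rpow_nonneg (hs l).le _)
  have hsub : Subsingleton (∀ l, Fin (k 0 l) → Fin M × Fin M × Bool) := by
    have : ∀ l, IsEmpty (Fin (k 0 l)) := fun l => by rw [hk0]; infer_instance
    infer_instance
  have hrad := rad_le_of_codes hn (v := fun t i => robustLoss loss B σ (w t) (S i))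
    (κ := fun j => ∀ l, Fin (k j l) → Fin M × Fin M × Bool) (fun j t => c j (w t))
    (K := Btil * r * (∏ l, (ρ l : ℝ) * s l) * (8 * (∑ l, layerCost s a l) ^ (3 / 2 : ℝ)))
    (H := Real.log (2 * (M : ℝ) ^ 2)) (by positivity)
    (Real.log_le_log (by norm_num) h2M)
    (fun j => by
      have hcard : (Fintype.card (∀ l, Fin (k j l) → Fin M × Fin M × Bool) : ℝ)
          = (2 * (M : ℝ) ^ 2) ^ (∑ l, k j l) := by
        rw [Fintype.card_pi, ← Finset.prod_pow_eq_pow_sum]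
        push_cast
        refine Finset.prod_congr rfl fun l _ => ?_
        simp only [Fintype.card_pi, Finset.prod_const, Fintype.card_prod, Fintype.card_fin,
          Fintype.card_bool, Finset.card_univ]
        push_cast
        ring
      rw [hcard, ← Real.exp_log (show (0 : ℝ) < 2 * (M : ℝ) ^ 2 by positivity), ← Real.exp_nat_mul,
        Real.exp_log (by positivity)]
      refine Real.exp_le_exp.2 ?_
      gcongr
      · exact Real.log_nonneg (by linarith)
      · exact hk j)
    (fun j t t' h i => by
      refine (abs_robustLoss_sub_le hσ hσ0 hs hB hLip h01 (hw t) (hw t') (hS i)).trans ?_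
      rw [mul_assoc _ (8 * _)]
      gcongr
      exact hc j _ (hw t) _ (hw t') h)
  have hsq : √(n * Real.log (2 * (M : ℝ) ^ 2)) / n = √(Real.log (2 * (M : ℝ) ^ 2)) / √n := by
    rw [Real.sqrt_mul hn'.le, div_eq_div_iff hn'.ne' (by positivity)]
    rw [mul_comm √(n : ℝ), mul_assoc, Real.mul_self_sqrt hn'.le]
  -- The constant is `2 * 18 * 8`: symmetrization, chaining, and the accuracy of the codes.
  calc _ ≤ 2 * (18 * (Btil * r * (∏ l, (ρ l : ℝ) * s l)
            * (8 * (∑ l, layerCost s a l) ^ (3 / 2 : ℝ)))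
            * √(n * Real.log (2 * (M : ℝ) ^ 2)) * (1 + Real.log n)) / n := by gcongr
    _ = 288 * (Btil * r * (∏ l, (ρ l : ℝ) * s l)
            * (∑ l, layerCost s a l) ^ (3 / 2 : ℝ))
            * (√(n * Real.log (2 * (M : ℝ) ^ 2)) / n) * (1 + Real.log n) := by ring
    _ = _ := by
      rw [hsq]
      simp only [logFactor, leadingTerm, layerCost]
      ring

end Complexity

/-! ### From a dense sequence of weights to the whole class. -/

section Approximation

variable {L : ℕ} {m : Fin (L + 1) → ℕ} {ρ : Fin L → ℝ≥0} {σ : Activations m} {s a : Fin L → ℝ}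
  {B : Vec (m 0) → Set (Vec (m 0))} {r : ℝ≥0}
  {loss : Vec (m (Fin.last L)) → Fin (m (Fin.last L)) → ℝ}

lemma zero_mem_weightClass (hs : ∀ l, 0 < s l) (ha : ∀ l, 0 ≤ a l) :
    (fun _ => 0 : Weights m) ∈ weightClass m s a := fun l => by
  simp [matSpectralNorm, entrywiseL1, (hs l).le, ha l]

/-- A sequence of weights in the class that is dense in it. -/
lemma exists_dense_seq_weightClass (hs : ∀ l, 0 < s l) (ha : ∀ l, 0 ≤ a l) :
    ∃ w : ℕ → Weights m, (∀ j, w j ∈ weightClass m s a) ∧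
      ∀ W ∈ weightClass m s a, ∃ u : ℕ → ℕ,
        Filter.Tendsto (fun k => w (u k)) Filter.atTop (nhds W) := by
  have : Nonempty (weightClass m s a) := ⟨⟨_, zero_mem_weightClass hs ha⟩⟩
  have : SecondCountableTopology (Weights m) :=
    inferInstanceAs (SecondCountableTopology
      ((i : Fin L) → Fin (m i.succ) → Fin (m i.castSucc) → ℝ))
  refine ⟨fun j => TopologicalSpace.denseSeq (weightClass m s a) j, fun j => Subtype.property _,
    fun W hW => ?_⟩
  obtain ⟨x, hx, hxW⟩ := mem_closure_iff_seq_limit.1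
    (TopologicalSpace.denseRange_denseSeq (weightClass m s a) ⟨W, hW⟩)
  choose u hu using hx
  refine ⟨u, ?_⟩
  simp only [hu]
  exact (continuous_subtype_val.tendsto _).comp hxW

lemma tendsto_robustLoss (hσ : ∀ i, LipschitzWith (ρ i) (σ i)) (hσ0 : ∀ i, σ i 0 = 0)
    (hs : ∀ l, 0 < s l) (hB : ∀ x, (B x).Nonempty) (hLip : ∀ y, LipschitzWith r fun v => loss v y)
    (h01 : ∀ v y, loss v y ∈ Set.Icc (0 : ℝ) 1) {w : ℕ → Weights m} {W : Weights m}
    (hw : ∀ k, w k ∈ weightClass m s a) (hW : W ∈ weightClass m s a)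
    (hwW : Filter.Tendsto w Filter.atTop (nhds W)) {p : Example m} {Btil : ℝ}
    (hp : ∀ x' ∈ B p.1, ‖x'‖ ≤ Btil) :
    Filter.Tendsto (fun k => robustLoss loss B σ (w k) p) Filter.atTop
      (nhds (robustLoss loss B σ W p)) := by
  have h0 := ((continuous_weightDist_right (s := s) W).tendsto W).comp hwW
  rw [weightDist_self] at h0
  have h1 := h0.const_mul (Btil * r * (∏ l, (ρ l : ℝ) * s l))
  rw [mul_zero] at h1
  rw [tendsto_iff_dist_tendsto_zero]
  refine squeeze_zero (fun _ => dist_nonneg) (fun k => ?_) h1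
  rw [dist_comm, Real.dist_eq]
  exact abs_robustLoss_sub_le hσ hσ0 hs hB hLip h01 hW (hw k) hp

/-- Lower semicontinuity in the weights of the robust loss. -/
lemma eventually_lt_robustLoss (hσ : ∀ i, LipschitzWith (ρ i) (σ i)) (hB : ∀ x, (B x).Nonempty)
    (hLip : ∀ y, LipschitzWith r fun v => loss v y)
    (h01 : ∀ v y, loss v y ∈ Set.Icc (0 : ℝ) 1) {w : ℕ → Weights m} {W : Weights m}
    (hwW : Filter.Tendsto w Filter.atTop (nhds W)) {p : Example m} {c : ℝ}
    (hc : c < robustLoss loss B σ W p) :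
    ∀ᶠ k in Filter.atTop, c < robustLoss loss B σ (w k) p := by
  have := (hB p.1).to_subtype
  -- One nearly worst perturbation, kept fixed, witnesses the inequality for nearby weights, so no
  -- bound on `B` is needed.
  obtain ⟨x', hx'⟩ := exists_lt_of_lt_ciSup hc
  have h : Filter.Tendsto (fun k => loss (net σ (w k) x') p.2) Filter.atTop
      (nhds (loss (net σ W x') p.2)) :=
    (((hLip p.2).continuous.comp (continuous_net hσ (x' : Vec (m 0)))).tendsto W).comp hwW
  filter_upwards [h.eventually_const_lt hx'] with k hk
  exact hk.trans_le (le_ciSup (bddAbove_range_loss h01 (w k) p) x')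

/-- A Fatou argument: lower semicontinuity makes `min (f k) g` converge pointwise to `g`, and
dominated convergence applies to these truncations. -/
lemma integral_le_of_eventually_lt {Ω : Type*} [MeasurableSpace Ω] {D : Measure Ω}
    [IsProbabilityMeasure D] {f : ℕ → Ω → ℝ} {g : Ω → ℝ} (hf : ∀ k, AEMeasurable (f k) D)
    (hg : AEMeasurable g D) (hf01 : ∀ k x, f k x ∈ Set.Icc (0 : ℝ) 1)
    (hg01 : ∀ x, g x ∈ Set.Icc (0 : ℝ) 1)
    (hlsc : ∀ x, ∀ c < g x, ∀ᶠ k in Filter.atTop, c < f k x) {b : ℕ → ℝ} {b' : ℝ}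
    (hb : Filter.Tendsto b Filter.atTop (nhds b')) (hfb : ∀ k, ∫ x, f k x ∂D ≤ b k) :
    ∫ x, g x ∂D ≤ b' := by
  have hmeas : ∀ k, AEMeasurable (fun x => min (f k x) (g x)) D := fun k => (hf k).min hg
  have h01 : ∀ k x, min (f k x) (g x) ∈ Set.Icc (0 : ℝ) 1 := fun k x =>
    ⟨le_min (hf01 k x).1 (hg01 x).1, (min_le_left _ _).trans (hf01 k x).2⟩
  have hlim : Filter.Tendsto (fun k => ∫ x, min (f k x) (g x) ∂D) Filter.atTop
      (nhds (∫ x, g x ∂D)) := by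
    refine tendsto_integral_of_dominated_convergence (fun _ => 1)
      (fun k => (hmeas k).aestronglyMeasurable) (integrable_const _)
      (fun k => .of_forall fun x => ?_) (.of_forall fun x => ?_)
    · rw [Real.norm_eq_abs, abs_of_nonneg (h01 k x).1]
      exact (h01 k x).2
    · rw [tendsto_order]
      refine ⟨fun c hc => ?_, fun c hc => .of_forall fun k => (min_le_right _ _).trans_lt hc⟩
      filter_upwards [hlsc x c hc] with k hk using lt_min hk hc
  refine le_of_tendsto_of_tendsto' hlim hb fun k => le_trans ?_ (hfb k)
  exact integral_mono (Integrable.of_mem_Icc 0 1 (hmeas k) (.of_forall (h01 k)))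
    (Integrable.of_mem_Icc 0 1 (hf k) (.of_forall (hf01 k))) fun x => min_le_left _ _

end Approximation

/-- The deviation bound for countable families of functions that are only a.e. measurable. -/
lemma exists_event_deviation_le_of_aemeasurable {Ω : Type*} [MeasurableSpace Ω] (D : Measure Ω)
    [IsProbabilityMeasure D] {f : ℕ → Ω → ℝ} (hf : ∀ j, AEMeasurable (f j) D)
    (h01 : ∀ j x, f j x ∈ Set.Icc (0 : ℝ) 1) {n : ℕ} (hn : 0 < n) {δ : ℝ} (hδ0 : 0 < δ)
    (hδ1 : δ < 1) :
    ∃ E : Set (Fin n → Ω), MeasurableSet E ∧ 1 - δ ≤ (Measure.pi fun _ : Fin n => D).real E ∧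
      ∀ S ∈ E, ∀ j, ∫ x, f j x ∂D - (1 / (n : ℝ)) * ∑ i, f j (S i)
        ≤ 2 * (rad fun j i => f j (S i)) / n + 5 * √(Real.log (1 / δ) / n) := by
  set g : ℕ → Ω → ℝ := fun j x => max 0 (min 1 ((hf j).mk _ x)) with hg
  have hgm : ∀ j, Measurable (g j) := fun j =>
    measurable_const.max (measurable_const.min (hf j).measurable_mk)
  have hg01 : ∀ j x, g j x ∈ Set.Icc (0 : ℝ) 1 := fun j x =>
    ⟨le_max_left _ _, max_le zero_le_one (min_le_left _ _)⟩
  have hfg : ∀ j, f j =ᵐ[D] g j := fun j => by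
    filter_upwards [(hf j).ae_eq_mk] with x hx
    simp only [hg, ← hx]
    rw [min_eq_right (h01 j x).2, max_eq_right (h01 j x).1]
  have hae : ∀ᵐ x ∂D, ∀ j, f j x = g j x := ae_all_iff.2 hfg
  -- Countability of the family gives one null set for all indices; samples that meet it are removed
  -- from the event.
  obtain ⟨A, hA, hAm, hAD⟩ := exists_measurable_superset_of_null (ae_iff.1 hae)
  obtain ⟨E, hE, hEδ, hEb⟩ := exists_event_deviation_le D hgm hg01 hn hδ0 hδ1
  have hAae : ∀ᵐ S ∂(Measure.pi fun _ : Fin n => D), ∀ i, S i ∈ Aᶜ := by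
    refine ae_all_iff.2 fun i => ?_
    refine (measurePreserving_eval (fun _ : Fin n => D) i).quasiMeasurePreserving.ae
      (p := fun x => x ∈ Aᶜ) ?_
    rw [ae_iff]
    simpa using hAD
  refine ⟨E ∩ ⋂ i, (fun S => S i) ⁻¹' Aᶜ, hE.inter (.iInter fun i =>
    (measurable_pi_apply i) hAm.compl), ?_, fun S hS j => ?_⟩
  · refine hEδ.trans (le_of_eq (measureReal_congr ?_))
    filter_upwards [hAae] with S hS
    refine propext ⟨fun h => ⟨h, Set.mem_iInter.2 hS⟩, fun h => h.1⟩
  · have hSA : ∀ i j, f j (S i) = g j (S i) := fun i j => by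
      have h : S i ∉ A := Set.mem_iInter.1 hS.2 i
      by_contra hne
      exact h (hA fun hall => hne (hall j))
    have h := hEb S hS.1 j
    rw [← integral_congr_ae (hfg j)] at h
    simpa only [hSA] using h

/-! ### The bound for Lipschitz losses. -/

section Bounds

variable {L : ℕ} {m : Fin (L + 1) → ℕ} {ρ : Fin L → ℝ≥0} {σ : Activations m} {s a : Fin L → ℝ}
  {B : Vec (m 0) → Set (Vec (m 0))}

lemma BoundsAdversarial.nonneg (hB : ∀ x, (B x).Nonempty) {n : ℕ} (hn : 0 < n)
    {S : Fin n → Example m} {Btil : ℝ} (h : BoundsAdversarial B S Btil) : 0 ≤ Btil := by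
  obtain ⟨x', hx'⟩ := hB (S ⟨0, hn⟩).1
  exact (norm_nonneg _).trans (h _ _ hx')

/-- The generalization bound for Lipschitz losses. -/
theorem exists_event_robustGap_le (hσ : ∀ i, LipschitzWith (ρ i) (σ i)) (hσ0 : ∀ i, σ i 0 = 0)
    (hs : ∀ l, 0 < s l) (ha : ∀ l, 0 ≤ a l) (hB : ∀ x, (B x).Nonempty)
    (D : Measure (Example m)) [IsProbabilityMeasure D] {n : ℕ} (hn : 0 < n) {δ : ℝ}
    (hδ0 : 0 < δ) (hδ1 : δ < 1) {r : ℝ≥0}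
    {loss : Vec (m (Fin.last L)) → Fin (m (Fin.last L)) → ℝ}
    (hLip : ∀ y, LipschitzWith r fun v => loss v y)
    (h01 : ∀ v y, loss v y ∈ Set.Icc (0 : ℝ) 1)
    (hMeas : ∀ W ∈ weightClass m s a, AEMeasurable (robustLoss loss B σ W) D) :
    ∃ E : Set (Fin n → Example m), MeasurableSet E ∧
      1 - δ ≤ (Measure.pi (fun _ : Fin n => D)).real E ∧
      ∀ S ∈ E, ∀ W ∈ weightClass m s a, ∀ Btil : ℝ, BoundsAdversarial B S Btil →
        robustGap loss B σ D S W ≤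
          288 * (logFactor n (maxWidth m) * leadingTerm n Btil r (fun i => (ρ i : ℝ)) s a
            + √(Real.log (1 / δ) / n)) := by
  obtain ⟨w, hw, hdense⟩ := exists_dense_seq_weightClass (m := m) hs ha
  obtain ⟨E, hE, hEδ, hEb⟩ := exists_event_deviation_le_of_aemeasurable D
    (f := fun j => robustLoss loss B σ (w j)) (fun j => hMeas _ (hw j))
    (fun j => robustLoss_mem_Icc hB h01 (w j)) hn hδ0 hδ1
  refine ⟨E, hE, hEδ, fun S hS W hW Btil hBtil => ?_⟩
  -- A sample point carries a label, so the last width is positive.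
  have hm : 0 < maxWidth m :=
    (Nat.zero_le _).trans_lt ((S ⟨0, hn⟩).2.isLt.trans_le
      (Finset.le_sup (f := m) (Finset.mem_univ (Fin.last L))))
  obtain ⟨u, hu⟩ := hdense W hW
  have hrad := rad_robustLoss_le hσ hσ0 hs ha hB hLip h01 hm hw hn (hBtil.nonneg hB hn) hBtil
  set b := 288 * (logFactor n (maxWidth m) * leadingTerm n Btil r (fun i => (ρ i : ℝ)) s a
    + √(Real.log (1 / δ) / n))
  have hsq : 0 ≤ √(Real.log (1 / δ) / n) := Real.sqrt_nonneg _
  have hlim : Filter.Tendsto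
      (fun k => (1 / (n : ℝ)) * ∑ i, robustLoss loss B σ (w (u k)) (S i) + b) Filter.atTop
      (nhds ((1 / (n : ℝ)) * ∑ i, robustLoss loss B σ W (S i) + b)) :=
    ((tendsto_finsetSum _ fun i _ => tendsto_robustLoss hσ hσ0 hs hB hLip h01
      (fun k => hw (u k)) hW hu (hBtil i)).const_mul _).add_const _
  have := integral_le_of_eventually_lt (fun k => hMeas _ (hw (u k))) (hMeas W hW)
    (fun k => robustLoss_mem_Icc hB h01 (w (u k))) (robustLoss_mem_Icc hB h01 W)
    (fun p c hc => eventually_lt_robustLoss hσ hB hLip h01 hu hc) hlim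
    (fun k => by
      have := hEb S hS (u k)
      simp only [b]
      linarith)
  unfold robustGap
  linarith

end Bounds

/-! ### The ramp loss. -/

section Ramp

variable {k : ℕ}

/-- The ramp function: `1` on `(-∞, 0]`, `0` on `[γ, ∞)`, affine in between. -/
noncomputable def ramp (γ t : ℝ) : ℝ := max 0 (min 1 (1 - t / γ))

/-- The ramp loss: the ramp function of the margin. -/
noncomputable def rampLoss (γ : ℝ) (v : Vec k) (y : Fin k) : ℝ :=
  ⨆ j, if j = y then 0 else ramp γ (v y - v j)

lemma ramp_mem_Icc (γ t : ℝ) : ramp γ t ∈ Set.Icc (0 : ℝ) 1 :=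
  ⟨le_max_left _ _, max_le zero_le_one (min_le_left _ _)⟩

lemma lt_ramp_iff {γ t c : ℝ} (hγ : 0 < γ) (hc0 : 0 ≤ c) (hc1 : c < 1) :
    c < ramp γ t ↔ t < γ * (1 - c) := by
  simp only [ramp, lt_max_iff, lt_min_iff, hc1, true_and, not_lt.2 hc0, false_or]
  rw [lt_sub_comm, div_lt_iff₀ hγ, mul_comm]

lemma abs_ramp_sub_le {γ : ℝ} (hγ : 0 < γ) (t t' : ℝ) :
    |ramp γ t - ramp γ t'| ≤ |t - t'| / γ := by
  unfold ramp
  refine (abs_max_sub_max_le_max _ _ _ _).trans ?_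
  rw [sub_self, abs_zero]
  refine max_le (by positivity) ((abs_min_sub_min_le_max _ _ _ _).trans ?_)
  rw [sub_self, abs_zero]
  refine max_le (by positivity) (le_of_eq ?_)
  rw [sub_sub_sub_cancel_left, ← sub_div, abs_div, abs_of_pos hγ, abs_sub_comm]

lemma rampLoss_term_mem_Icc (γ : ℝ) (v : Vec k) (y j : Fin k) :
    (if j = y then 0 else ramp γ (v y - v j)) ∈ Set.Icc (0 : ℝ) 1 := by
  split_ifs
  · simp
  · exact ramp_mem_Icc _ _

lemma bddAbove_range_rampLoss_term (γ : ℝ) (v : Vec k) (y : Fin k) :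
    BddAbove (Set.range fun j => if j = y then 0 else ramp γ (v y - v j)) :=
  (Set.finite_range _).bddAbove

lemma rampLoss_mem_Icc (γ : ℝ) (v : Vec k) (y : Fin k) : rampLoss γ v y ∈ Set.Icc (0 : ℝ) 1 :=
  have : Nonempty (Fin k) := ⟨y⟩
  ⟨(rampLoss_term_mem_Icc γ v y y).1.trans (le_ciSup (bddAbove_range_rampLoss_term γ v y) y),
    ciSup_le fun j => (rampLoss_term_mem_Icc γ v y j).2⟩

lemma lt_rampLoss_iff {γ c : ℝ} (hγ : 0 < γ) (hc0 : 0 ≤ c) (hc1 : c < 1) (v : Vec k)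
    (y : Fin k) : c < rampLoss γ v y ↔ ∃ j, j ≠ y ∧ v y - v j < γ * (1 - c) := by
  have : Nonempty (Fin k) := ⟨y⟩
  unfold rampLoss
  rw [lt_ciSup_iff (bddAbove_range_rampLoss_term γ v y)]
  refine exists_congr fun j => ?_
  split_ifs with h
  · simp [h, not_lt.2 hc0]
  · simp [h, lt_ramp_iff hγ hc0 hc1]

lemma rampLoss_eq_one {γ : ℝ} (hγ : 0 < γ) {v : Vec k} {y j : Fin k} (hj : j ≠ y)
    (h : v y ≤ v j) : rampLoss γ v y = 1 := by
  refine le_antisymm (rampLoss_mem_Icc γ v y).2 (le_of_forall_lt fun c hc => ?_)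
  rcases lt_or_ge c 0 with h0 | h0
  · exact h0.trans_le (rampLoss_mem_Icc γ v y).1
  · refine (lt_rampLoss_iff hγ h0 hc v y).2 ⟨j, hj, lt_of_le_of_lt (sub_nonpos.2 h) ?_⟩
    exact mul_pos hγ (by linarith)

/-- A margin is a difference of two coordinates, each `1`-Lipschitz, and the ramp has slope `1 / γ`.
-/
lemma lipschitzWith_rampLoss {γ : ℝ} (hγ : 0 < γ) {r : ℝ≥0} (hr : (r : ℝ) = 2 / γ) (y : Fin k) :
    LipschitzWith r fun v : Vec k => rampLoss γ v y := by
  have : Nonempty (Fin k) := ⟨y⟩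
  refine LipschitzWith.of_dist_le_mul fun v v' => ?_
  rw [Real.dist_eq, dist_eq_norm, hr]
  refine abs_ciSup_sub_ciSup_le (bddAbove_range_rampLoss_term γ v y)
    (bddAbove_range_rampLoss_term γ v' y) fun j => ?_
  split_ifs
  · simp only [sub_self, abs_zero]; positivity
  · refine (abs_ramp_sub_le hγ _ _).trans ?_
    have h : ∀ i, |v i - v' i| ≤ ‖v - v'‖ := fun i => by
      simpa using PiLp.norm_apply_le (v - v') i
    rw [div_mul_eq_mul_div]
    gcongr
    rw [sub_sub_sub_comm]
    refine (abs_sub _ _).trans ?_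
    linarith [h y, h j]

end Ramp

/-! ### The margin bound. -/

section Margin

variable {L : ℕ} {m : Fin (L + 1) → ℕ} {ρ : Fin L → ℝ≥0} {σ : Activations m} {s a : Fin L → ℝ}
  {B : Vec (m 0) → Set (Vec (m 0))} {γ : ℝ}

/-- Reduces measurability of the robust ramp loss to that of countably many margin events with
thresholds in `[0, γ]`. -/
lemma setOf_lt_robustLoss_rampLoss (hγ : 0 < γ) (hB : ∀ x, (B x).Nonempty) (W : Weights m)
    {c : ℝ} (hc0 : 0 ≤ c) (hc1 : c < 1) :
    {p | c < robustLoss (rampLoss γ) B σ W p}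
      = ⋃ q : {q : ℚ // 0 ≤ (q : ℝ) ∧ (q : ℝ) < γ * (1 - c)}, robustMarginErrorSet B σ q.1 W := by
  ext p
  have := (hB p.1).to_subtype
  have h1 : c < robustLoss (rampLoss γ) B σ W p
      ↔ ∃ x' : B p.1, ∃ j, j ≠ p.2 ∧ net σ W x' p.2 - net σ W x' j < γ * (1 - c) := by
    unfold robustLoss
    rw [lt_ciSup_iff (bddAbove_range_loss (rampLoss_mem_Icc γ) W p)]
    exact exists_congr fun x' => lt_rampLoss_iff hγ hc0 hc1 _ _
  have hpos : 0 < γ * (1 - c) := mul_pos hγ (by linarith)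
  simp only [Set.mem_ofPred_eq, h1, Set.mem_iUnion, robustMarginErrorSet, Subtype.exists]
  constructor
  · rintro ⟨x', hx', j, hj, h⟩
    -- The maximum with `0` keeps the rational threshold nonnegative even when the margin is
    -- negative.
    obtain ⟨q, hq1, hq2⟩ := exists_rat_btwn (max_lt hpos h)
    exact ⟨q, ⟨(le_max_left _ _).trans hq1.le, hq2⟩, x', hx', j, hj, by
      linarith [(le_max_right _ _).trans hq1.le]⟩
  · rintro ⟨q, ⟨_, hq2⟩, x', hx', j, hj, h⟩
    exact ⟨x', hx', j, hj, by linarith⟩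

lemma aemeasurable_robustLoss_rampLoss (hγ : 0 < γ) (hB : ∀ x, (B x).Nonempty)
    {D : Measure (Example m)} {W : Weights m}
    (h : ∀ t ∈ Set.Icc 0 γ, NullMeasurableSet (robustMarginErrorSet B σ t W) D) :
    AEMeasurable (robustLoss (rampLoss γ) B σ W) D := by
  refine NullMeasurable.aemeasurable ?_
  refine measurable_of_Ioi (δ := NullMeasurableSpace (Example m) D) fun c => ?_
  change NullMeasurableSet {p | c < robustLoss (rampLoss γ) B σ W p} D
  have h01 := robustLoss_mem_Icc (σ := σ) hB (rampLoss_mem_Icc γ) W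
  rcases lt_or_ge c 0 with hc0 | hc0
  · rw [show {p | c < robustLoss (rampLoss γ) B σ W p} = Set.univ from
      Set.eq_univ_of_forall fun p => hc0.trans_le (h01 p).1]
    exact .univ
  rcases lt_or_ge c 1 with hc1 | hc1
  · rw [setOf_lt_robustLoss_rampLoss hγ hB W hc0 hc1]
    exact .iUnion fun q => h _ ⟨q.2.1, q.2.2.le.trans (by nlinarith)⟩
  · rw [show {p | c < robustLoss (rampLoss γ) B σ W p} = ∅ from
      Set.eq_empty_of_forall_notMem fun p hp => absurd (hp.trans_le (h01 p).2) (not_lt.2 hc1)]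
    exact .empty

/-- On a robust error the chosen label beats or ties the true one, so the ramp loss equals `1`;
Markov's inequality at level `1` concludes. Only monotonicity of `D` is applied to the error set,
which may be nonmeasurable. -/
lemma measureReal_robustErrorSet_le (hγ : 0 < γ) (hB : ∀ x, (B x).Nonempty)
    {D : Measure (Example m)} [IsProbabilityMeasure D] {W : Weights m}
    {pick : Vec (m (Fin.last L)) → Fin (m (Fin.last L))}
    (hpick : ∀ (v : Vec (m (Fin.last L))) j, v j ≤ v (pick v))
    (hm : AEMeasurable (robustLoss (rampLoss γ) B σ W) D) :
    D.real (robustErrorSet pick B σ W) ≤ ∫ p, robustLoss (rampLoss γ) B σ W p ∂D := by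
  have h01 := robustLoss_mem_Icc (σ := σ) hB (rampLoss_mem_Icc γ) W
  have hsub : robustErrorSet pick B σ W ⊆ {p | 1 ≤ robustLoss (rampLoss γ) B σ W p} := by
    rintro p ⟨x', hx', hne⟩
    have h := le_ciSup (bddAbove_range_loss (rampLoss_mem_Icc γ) (σ := σ) W p) ⟨x', hx'⟩
    rw [rampLoss_eq_one hγ hne.symm (hpick _ _)] at h
    exact h
  have h := mul_meas_ge_le_integral_of_nonneg (μ := D) (.of_forall fun p => (h01 p).1)
    (Integrable.of_mem_Icc 0 1 hm (.of_forall h01)) 1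
  rw [one_mul] at h
  exact (measureReal_mono hsub).trans h

lemma robustLoss_rampLoss_le_indicator (hγ : 0 < γ) (hB : ∀ x, (B x).Nonempty) (W : Weights m)
    (p : Example m) : robustLoss (rampLoss γ) B σ W p
      ≤ (robustMarginErrorSet B σ γ W).indicator (fun _ => (1 : ℝ)) p := by
  have := (hB p.1).to_subtype
  by_cases hp : p ∈ robustMarginErrorSet B σ γ W
  · rw [Set.indicator_of_mem hp]
    exact (robustLoss_mem_Icc hB (rampLoss_mem_Icc γ) W p).2
  · rw [Set.indicator_of_notMem hp]
    refine ciSup_le fun x' => not_lt.1 fun h => hp ?_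
    obtain ⟨j, hj, h'⟩ := (lt_rampLoss_iff hγ le_rfl one_pos _ _).1 h
    exact ⟨x', x'.2, j, hj, by linarith⟩

/-- The generalization bound for the margin loss. -/
theorem exists_event_robustMarginGap_le (hσ : ∀ i, LipschitzWith (ρ i) (σ i))
    (hσ0 : ∀ i, σ i 0 = 0) (hs : ∀ l, 0 < s l) (ha : ∀ l, 0 ≤ a l) (hB : ∀ x, (B x).Nonempty)
    (D : Measure (Example m)) [IsProbabilityMeasure D] {n : ℕ} (hn : 0 < n) {δ : ℝ}
    (hδ0 : 0 < δ) (hδ1 : δ < 1) (hγ : 0 < γ)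
    {pick : Vec (m (Fin.last L)) → Fin (m (Fin.last L))}
    (hpick : ∀ (v : Vec (m (Fin.last L))) j, v j ≤ v (pick v))
    (hMeas : ∀ W ∈ weightClass m s a, ∀ t ∈ Set.Icc 0 γ,
      NullMeasurableSet (robustMarginErrorSet B σ t W) D) :
    ∃ E : Set (Fin n → Example m), MeasurableSet E ∧
      1 - δ ≤ (Measure.pi (fun _ : Fin n => D)).real E ∧
      ∀ S ∈ E, ∀ W ∈ weightClass m s a, ∀ Btil : ℝ, BoundsAdversarial B S Btil →
        robustMarginGap pick B σ γ D S W ≤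
          576 * (logFactor n (maxWidth m) * leadingTerm n Btil (1 / γ) (fun i => (ρ i : ℝ)) s a
            + √(Real.log (1 / δ) / n)) := by
  have hmeas : ∀ W ∈ weightClass m s a, AEMeasurable (robustLoss (rampLoss γ) B σ W) D :=
    fun W hW => aemeasurable_robustLoss_rampLoss hγ hB (hMeas W hW)
  obtain ⟨r, hr⟩ : ∃ r : ℝ≥0, (r : ℝ) = 2 / γ := ⟨⟨2 / γ, by positivity⟩, rfl⟩
  obtain ⟨E, hE, hEδ, hEb⟩ := exists_event_robustGap_le hσ hσ0 hs ha hB D hn hδ0 hδ1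
    (lipschitzWith_rampLoss hγ hr) (rampLoss_mem_Icc γ) hmeas
  refine ⟨E, hE, hEδ, fun S hS W hW Btil hBtil => ?_⟩
  have h := hEb S hS W hW Btil hBtil
  have hlead : leadingTerm n Btil r (fun i => (ρ i : ℝ)) s a
      = 2 * leadingTerm n Btil (1 / γ) (fun i => (ρ i : ℝ)) s a := by
    simp only [leadingTerm, hr]
    ring
  rw [hlead] at h
  have h1 := measureReal_robustErrorSet_le hγ hB hpick (hmeas W hW)
  have h2 : (1 / (n : ℝ)) * ∑ i, robustLoss (rampLoss γ) B σ W (S i) ≤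
      (1 / (n : ℝ)) * ∑ i, (robustMarginErrorSet B σ γ W).indicator (fun _ => (1 : ℝ)) (S i) := by
    gcongr with i
    exact robustLoss_rampLoss_le_indicator hγ hB W (S i)
  have hsq : 0 ≤ √(Real.log (1 / δ) / n) := Real.sqrt_nonneg _
  unfold robustGap at h
  unfold robustMarginGap
  linarith

end Margin

lemma logFactor_mul_leadingTerm_nonneg {L n M : ℕ} (hn : 0 < n) {Btil r : ℝ} (hBtil : 0 ≤ Btil)
    (hr : 0 ≤ r) {ρ s a : Fin L → ℝ} (hρ : ∀ l, 0 ≤ ρ l) (hs : ∀ l, 0 < s l)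
    (ha : ∀ l, 0 ≤ a l) : 0 ≤ logFactor n M * leadingTerm n Btil r ρ s a := by
  have h1 : 0 ≤ Real.log n := Real.log_nonneg (by exact_mod_cast hn)
  have h2 : 0 ≤ ∏ l, ρ l * s l := Finset.prod_nonneg fun l _ => mul_nonneg (hρ l) (hs l).le
  have h3 : 0 ≤ ∑ l, a l ^ (2 / 3 : ℝ) / s l ^ (2 / 3 : ℝ) := Finset.sum_nonneg fun l _ =>
    div_nonneg (Real.rpow_nonneg (ha l) _) (Real.rpow_nonneg (hs l).le _)
  unfold logFactor leadingTerm
  positivity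

end RobustNet

theorem theorem1 :
    ∃ C : ℝ, 0 < C ∧
      ∀ (L : ℕ) (m : Fin (L + 1) → ℕ)
        (ρ : Fin L → ℝ≥0) (σ : RobustNet.Activations m)
        (_hσ : ∀ i, LipschitzWith (ρ i) (σ i)) (_hσ0 : ∀ i, σ i 0 = 0)
        (s a : Fin L → ℝ) (_hs : ∀ i, 0 < s i) (_ha : ∀ i, 0 ≤ a i)
        (B : RobustNet.Vec (m 0) → Set (RobustNet.Vec (m 0))) (_hB : ∀ x, (B x).Nonempty)
        (D : Measure (RobustNet.Example m)) (_hD : IsProbabilityMeasure D)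
        (n : ℕ) (_hn : 0 < n) (δ : ℝ) (_hδ0 : 0 < δ) (_hδ1 : δ < 1),
        -- generalization bound for a Lipschitz loss
        (∀ (r : ℝ≥0)
          (loss : RobustNet.Vec (m (Fin.last L)) → Fin (m (Fin.last L)) → ℝ)
          (_hLip : ∀ y, LipschitzWith r (fun v => loss v y))
          (_hRange : ∀ v y, loss v y ∈ Set.Icc (0 : ℝ) 1)
          (_hMeas : ∀ W ∈ RobustNet.weightClass m s a,
            AEMeasurable (RobustNet.robustLoss loss B σ W) D),
          ∃ E : Set (Fin n → RobustNet.Example m), MeasurableSet E ∧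
            1 - δ ≤ (Measure.pi (fun _ : Fin n => D)).real E ∧
            ∀ S ∈ E, ∀ W ∈ RobustNet.weightClass m s a, ∀ Btil : ℝ,
              RobustNet.BoundsAdversarial B S Btil →
              RobustNet.robustGap loss B σ D S W ≤
                C * (RobustNet.logFactor n (RobustNet.maxWidth m) *
                    RobustNet.leadingTerm n Btil r (fun i => (ρ i : ℝ)) s a
                  + √(Real.log (1 / δ) / n))) ∧
        -- margin bound
        (∀ (γ : ℝ) (_hγ : 0 < γ)
          (pick : RobustNet.Vec (m (Fin.last L)) → Fin (m (Fin.last L)))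
          (_hpick : ∀ (v : RobustNet.Vec (m (Fin.last L))) j, v j ≤ v (pick v))
          (_hMeas : ∀ W ∈ RobustNet.weightClass m s a, ∀ t ∈ Set.Icc 0 γ,
            NullMeasurableSet (RobustNet.robustMarginErrorSet B σ t W) D),
          ∃ E : Set (Fin n → RobustNet.Example m), MeasurableSet E ∧
            1 - δ ≤ (Measure.pi (fun _ : Fin n => D)).real E ∧
            ∀ S ∈ E, ∀ W ∈ RobustNet.weightClass m s a, ∀ Btil : ℝ,
              RobustNet.BoundsAdversarial B S Btil →
              RobustNet.robustMarginGap pick B σ γ D S W ≤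
                C * (RobustNet.logFactor n (RobustNet.maxWidth m) *
                    RobustNet.leadingTerm n Btil (1 / γ) (fun i => (ρ i : ℝ)) s a
                  + √(Real.log (1 / δ) / n))) := by
  -- `576 = 2 * 288`, the doubling due to the Lipschitz constant `2 / γ` of the ramp loss.
  refine ⟨576, by norm_num, fun L m ρ σ hσ hσ0 s a hs ha B hB D hD n hn δ hδ0 hδ1 =>
    ⟨fun r loss hLip hRange hMeas => ?_, fun γ hγ pick hpick hMeas =>
      RobustNet.exists_event_robustMarginGap_le hσ hσ0 hs ha hB D hn hδ0 hδ1 hγ hpick hMeas⟩⟩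
  obtain ⟨E, hE, hEδ, hEb⟩ :=
    RobustNet.exists_event_robustGap_le hσ hσ0 hs ha hB D hn hδ0 hδ1 hLip hRange hMeas
  refine ⟨E, hE, hEδ, fun S hS W hW Btil hBtil => (hEb S hS W hW Btil hBtil).trans ?_⟩
  have h := RobustNet.logFactor_mul_leadingTerm_nonneg (M := RobustNet.maxWidth m) hn
    (hBtil.nonneg hB hn) r.2 (fun i => (ρ i).2) hs ha
  gcongr
  norm_num
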